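/- Let $p$ be a prime, $k$ an arbitrary field of characteristic $p$, $E=k((t))$ with its $t$-adic valuation $v$, and $G_E=\mathrm{Gal}(E^{\mathrm{sep}}/E)$. For an $\mathbb{F}_p$-algebra $R$ let $W_m(R)$ be the ring of Witt vectors $(x_0,\dots,x_m)$ of length $m+1$, let $\bar F(x_0,\dots,x_m)=(x_0^p,\dots,x_m^p)$, and let $CW(R)=\varinjlim(W_0(R)\xrightarrow{V}W_1(R)\xrightarrow{V}\cdots)$ be the group of Witt covectors. Let $\delta:CW(E)\to\mathrm{Hom}^{\mathrm{cont}}(G_E,\mathbb{Q}_p/\mathbb{Z}_p)$ be the Artin–Schreier–Witt morphism: for $x\in W_m(E)$ one has $\delta(x)(\gamma)=\gamma(\nu)-\nu\in\mathbb{Z}/p^{m+1}\mathbb{Z}=p^{-(m+1)}\mathbb{Z}/\mathbb{Z}$, where $\nu\in W_m(E^{\mathrm{sep}})$ satisfies $\bar F(\nu)-\nu=x$. For $d\ge 0$ let $\mathrm{Fil}_d(CW(E))$ be the union over $s$ of the images of $\{x\in W_s(E) : \min_i p^{s-i}v(x_i)\ge -d\}$. For a continuous character $\alpha:G_E\to\mathbb{Q}/\mathbb{Z}$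 with $p$-primary part $\alpha_p:G_E\to\mathbb{Q}_p/\mathbb{Z}_p$, the Kato Swan conductor is $\mathrm{sw}(\alpha)=\min\{d\ge 0 : \alpha_p\in\delta(\mathrm{Fil}_d(CW(E)))\}$. Let $m\ge 0$, let $n\ge 1$ be prime to $p$, let $j\ge 0$, and let $\lambda=(\lambda_0,\dots,\lambda_m)\in p^jW_m(k)\setminus p^{j+1}W_m(k)$ (so that $j\le m$). Let $\lambda t^{-np^m}\in CW(E)$ be the class of $(\lambda_0t^{-n},\lambda_1t^{-np},\dots,\lambda_mt^{-np^m})\in W_m(E)$, and let $\alpha^-=\delta(\lambda t^{-np^m})$, viewed as a character with values in $\mathbb{Q}_p/\mathbb{Z}_p\subset\mathbb{Q}/\mathbb{Z}$. Then $\mathrm{sw}(\alpha^-)=np^{m-j}$. -/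

import Mathlib

noncomputable section

namespace KatoSwan

open WittVector

section Witt

variable (p : ℕ) [Fact p.Prime]

/-- `W p m R` is the ring of Witt vectors `(x_0, …, x_m)` of length `m + 1`,
i.e. `W(R) / V^(m+1) W(R)`. -/
abbrev W (m : ℕ) (R : Type*) [CommRing R] : Type _ := TruncatedWittVector p (m + 1) R

variable {p}
variable {R S : Type*} [CommRing R] [CommRing S] {m : ℕ}

/-- The Frobenius `(x_0, …, x_m) ↦ (x_0 ^ p, …, x_m ^ p)`. -/
def frob (x : W p m R) : W p m R := TruncatedWittVector.mk p fun l => x.coeff l ^ p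

theorem frob_truncate [CharP R p] (w : WittVector p R) :
    frob (WittVector.truncate (m + 1) w : W p m R) =
      WittVector.truncate (m + 1) (WittVector.frobenius w) := by
  ext l
  simp [frob, WittVector.coeff_frobenius_charP]

theorem frob_add [CharP R p] (x y : W p m R) : frob (x + y) = frob x + frob y := by
  obtain ⟨x, rfl⟩ := WittVector.truncate_surjective p (m + 1) R x
  obtain ⟨y, rfl⟩ := WittVector.truncate_surjective p (m + 1) R y
  simp only [← map_add, frob_truncate]

theorem frob_sub [CharP R p] (x y : W p m R) : frob (x - y) = frob x - frob y := by
  rw [eq_sub_iff_add_eq, ← frob_add, sub_add_cancel]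

/-- Functoriality: the ring homomorphism `(x_0, …, x_m) ↦ (f x_0, …, f x_m)`. -/
def mapW (m : ℕ) (f : R →+* S) : W p m R →+* W p m S where
  toFun x := TruncatedWittVector.mk p fun l => f (x.coeff l)
  map_one' := by
    have h : (TruncatedWittVector.mk p fun l : Fin (m + 1) =>
        f ((WittVector.truncate (m + 1) (1 : WittVector p R)).coeff l)) =
        WittVector.truncate (m + 1) (WittVector.map f 1) := by
      ext l; simp only [TruncatedWittVector.coeff_mk, WittVector.coeff_truncate,
        WittVector.map_coeff]
    rw [map_one, map_one, map_one] at h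
    exact h
  map_zero' := by
    ext l; simp
  map_mul' x y := by
    obtain ⟨x, rfl⟩ := WittVector.truncate_surjective p (m + 1) R x
    obtain ⟨y, rfl⟩ := WittVector.truncate_surjective p (m + 1) R y
    have h : ∀ z : WittVector p R, (TruncatedWittVector.mk p fun l : Fin (m + 1) =>
        f ((WittVector.truncate (m + 1) z).coeff l)) =
        WittVector.truncate (m + 1) (WittVector.map f z) := by
      intro z; ext l; simp
    rw [← map_mul, h, h, h, map_mul, map_mul]
  map_add' x y := by
    obtain ⟨x, rfl⟩ := WittVector.truncate_surjective p (m + 1) R x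
    obtain ⟨y, rfl⟩ := WittVector.truncate_surjective p (m + 1) R y
    have h : ∀ z : WittVector p R, (TruncatedWittVector.mk p fun l : Fin (m + 1) =>
        f ((WittVector.truncate (m + 1) z).coeff l)) =
        WittVector.truncate (m + 1) (WittVector.map f z) := by
      intro z; ext l; simp
    rw [← map_add, h, h, h, map_add, map_add]

@[simp]
theorem coeff_mapW (f : R →+* S) (x : W p m R) (l : Fin (m + 1)) :
    (mapW m f x).coeff l = f (x.coeff l) :=
  TruncatedWittVector.coeff_mk _ _

theorem frob_mapW (f : R →+* S) (x : W p m R) : frob (mapW m f x) = mapW m f (frob x) := by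
  ext l; simp [frob]

/-- The iterated Verschiebung `V ^ (j - i) : W_i(R) → W_j(R)`,
`(x_0, …, x_i) ↦ (0, …, 0, x_0, …, x_i)`, as a plain map. -/
def vFun {i j : ℕ} (h : i ≤ j) (x : W p i R) : W p j R :=
  TruncatedWittVector.mk p fun l =>
    if (l : ℕ) < j - i then 0 else x.coeff ⟨(l : ℕ) - (j - i), by have := l.2; omega⟩

theorem vFun_truncate {i j : ℕ} (h : i ≤ j) (w : WittVector p R) :
    vFun h (WittVector.truncate (i + 1) w) =
      WittVector.truncate (j + 1) (WittVector.verschiebung^[j - i] w) := by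
  ext l
  simp only [vFun, TruncatedWittVector.coeff_mk, WittVector.coeff_truncate]
  split_ifs with hl
  · rw [WittVector.iterate_verschiebung_coeff_eq_zero _ hl]
  · have e : (l : ℕ) = ((l : ℕ) - (j - i)) + (j - i) := by omega
    conv_rhs => rw [e, WittVector.iterate_verschiebung_coeff]

/-- The iterated Verschiebung `V ^ (j - i) : W_i(R) → W_j(R)` is additive. -/
def vMap (i j : ℕ) (h : i ≤ j) : W p i R →+ W p j R where
  toFun := vFun h
  map_zero' := by
    ext l; simp [vFun]
  map_add' x y := by
    obtain ⟨x, rfl⟩ := WittVector.truncate_surjective p (i + 1) R x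
    obtain ⟨y, rfl⟩ := WittVector.truncate_surjective p (i + 1) R y
    rw [← map_add, vFun_truncate, vFun_truncate, vFun_truncate, iterate_map_add, map_add]

theorem vMap_truncate {i j : ℕ} (h : i ≤ j) (w : WittVector p R) :
    vMap i j h (WittVector.truncate (i + 1) w) =
      WittVector.truncate (j + 1) (WittVector.verschiebung^[j - i] w) :=
  vFun_truncate h w

theorem frob_vMap {i j : ℕ} (h : i ≤ j) (x : W p i R) :
    frob (vMap i j h x) = vMap i j h (frob x) := by
  have hp : p ≠ 0 := (Fact.out : p.Prime).ne_zero
  ext l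
  change (if (l : ℕ) < j - i then (0 : R) else _) ^ p = if (l : ℕ) < j - i then (0 : R) else _
  split_ifs
  · exact zero_pow hp
  · rfl

theorem mapW_vMap (f : R →+* S) {i j : ℕ} (h : i ≤ j) (x : W p i R) :
    mapW j f (vMap i j h x) = vMap i j h (mapW i f x) := by
  ext l
  change f (if (l : ℕ) < j - i then (0 : R) else _) = if (l : ℕ) < j - i then (0 : S) else _
  split_ifs
  · exact map_zero f
  · rfl

variable (p) in
/-- The group of Witt co-vectors: the direct limit of `W_0(R) → W_1(R) → ⋯` along the
Verschiebung maps. -/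
abbrev CW (R : Type*) [CommRing R] : Type _ :=
  AddCommGroup.DirectLimit (fun m : ℕ => W p m R) (fun i j h => vMap i j h)

variable (p) in
/-- The canonical map `W_m(R) → CW(R)`. -/
abbrev toCW (m : ℕ) (R : Type*) [CommRing R] : W p m R →+ CW p R :=
  AddCommGroup.DirectLimit.of (fun m : ℕ => W p m R) (fun i j h => vMap i j h) m

end Witt

section Coefficients

/-- The group `ℚ / ℤ`. -/
def QmodZ : Type := ℚ ⧸ AddSubgroup.zmultiples (1 : ℚ)

instance : AddCommGroup QmodZ :=
  inferInstanceAs (AddCommGroup (ℚ ⧸ AddSubgroup.zmultiples (1 : ℚ)))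

/-- `ℚ / ℤ` carries the discrete topology. -/
instance : TopologicalSpace QmodZ := ⊥

instance : DiscreteTopology QmodZ := ⟨rfl⟩

/-- The class of a rational number in `ℚ / ℤ`. -/
def QmodZ.mk : ℚ →+ QmodZ := QuotientAddGroup.mk' (AddSubgroup.zmultiples (1 : ℚ))

variable (p : ℕ) [Fact p.Prime]

/-- The group `ℚ_p / ℤ_p`. -/
def QpModZp : Type := ℚ_[p] ⧸ (PadicInt.subring p).toAddSubgroup

instance : AddCommGroup (QpModZp p) :=
  inferInstanceAs (AddCommGroup (ℚ_[p] ⧸ (PadicInt.subring p).toAddSubgroup))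

/-- `ℚ_p / ℤ_p` carries the discrete topology. -/
instance : TopologicalSpace (QpModZp p) := ⊥

instance : DiscreteTopology (QpModZp p) := ⟨rfl⟩

/-- The class of a `p`-adic number in `ℚ_p / ℤ_p`. -/
def QpModZp.mk : ℚ_[p] →+ QpModZp p := QuotientAddGroup.mk' (PadicInt.subring p).toAddSubgroup

theorem QpModZp.mk_eq_zero (x : ℚ_[p]) : QpModZp.mk p x = 0 ↔ ‖x‖ ≤ 1 :=
  (QuotientAddGroup.eq_zero_iff (N := (PadicInt.subring p).toAddSubgroup) x).trans Iff.rfl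

theorem QmodZ.mk_eq_zero (x : ℚ) : QmodZ.mk x = 0 ↔ ∃ z : ℤ, (z : ℚ) = x :=
  (QuotientAddGroup.eq_zero_iff (N := AddSubgroup.zmultiples (1 : ℚ)) x).trans (by
    simp [AddSubgroup.mem_zmultiples_iff])

/-- The projection of `ℚ / ℤ = ⨁ ℚ_ℓ / ℤ_ℓ` onto `ℚ_p / ℤ_p`, induced by `ℚ ⊆ ℚ_p`. -/
def proj : QmodZ →+ QpModZp p :=
  QuotientAddGroup.map (AddSubgroup.zmultiples (1 : ℚ)) (PadicInt.subring p).toAddSubgroup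
    (Rat.castHom ℚ_[p]).toAddMonoidHom (by
      rw [AddSubgroup.zmultiples_le]
      change ((1 : ℚ) : ℚ_[p]) ∈ PadicInt.subring p
      rw [Rat.cast_one]
      exact one_mem _)

theorem proj_mk (x : ℚ) : proj p (QmodZ.mk x) = QpModZp.mk p (x : ℚ_[p]) := rfl

theorem proj_injOn (x : QmodZ) (N : ℕ) (hx : p ^ N • x = 0) (h : proj p x = 0) : x = 0 := by
  obtain ⟨q, rfl⟩ := QuotientAddGroup.mk'_surjective _ x
  change p ^ N • QmodZ.mk q = 0 at hx
  change proj p (QmodZ.mk q) = 0 at h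
  change QmodZ.mk q = 0
  have hp0 : (p : ℚ) ≠ 0 := by exact_mod_cast (Fact.out : p.Prime).ne_zero
  rw [← map_nsmul, QmodZ.mk_eq_zero] at hx
  obtain ⟨z, hz⟩ := hx
  rw [proj_mk, QpModZp.mk_eq_zero] at h
  have hq : ((z : ℤ) : ℚ_[p]) = (p : ℚ_[p]) ^ N * (q : ℚ_[p]) := by
    have := congrArg (fun r : ℚ => (r : ℚ_[p])) hz
    simpa using this
  have hn : ‖((z : ℤ) : ℚ_[p])‖ ≤ (p : ℝ) ^ (-(N : ℤ)) := by
    rw [hq, norm_mul, norm_pow, Padic.norm_p, zpow_neg, zpow_natCast, inv_pow]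
    exact mul_le_of_le_one_right (by positivity) h
  rw [Padic.norm_int_le_pow_iff_dvd] at hn
  obtain ⟨c, hc⟩ := hn
  rw [QmodZ.mk_eq_zero]
  refine ⟨c, ?_⟩
  have h2 : ((p : ℚ) ^ N) * c = p ^ N * q := by
    have : ((z : ℤ) : ℚ) = (p : ℚ) ^ N * c := by rw [hc]; push_cast; rfl
    rw [← this, hz]; simp
  exact mul_left_cancel₀ (pow_ne_zero _ hp0) h2

theorem exists_lift (y : QpModZp p) : ∃ x : QmodZ, (∃ N : ℕ, p ^ N • x = 0) ∧ proj p x = y := by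
  obtain ⟨y, rfl⟩ := QuotientAddGroup.mk'_surjective _ y
  change ∃ x : QmodZ, (∃ N : ℕ, p ^ N • x = 0) ∧ proj p x = QpModZp.mk p y
  have hp0 : (p : ℚ_[p]) ≠ 0 := by exact_mod_cast (Fact.out : p.Prime).ne_zero
  have hp1 : (1 : ℝ) < p := by exact_mod_cast (Fact.out : p.Prime).one_lt
  have hpq : (p : ℚ) ≠ 0 := by exact_mod_cast (Fact.out : p.Prime).ne_zero
  obtain ⟨N, hN⟩ := pow_unbounded_of_one_lt ‖y‖ hp1
  have hy : ‖(p : ℚ_[p]) ^ N * y‖ ≤ 1 := by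
    rw [norm_mul, norm_pow, Padic.norm_p, inv_pow]
    rw [inv_mul_le_iff₀ (by positivity)]
    simpa using hN.le
  let u : ℤ_[p] := ⟨(p : ℚ_[p]) ^ N * y, hy⟩
  have hu := PadicInt.appr_spec N u
  rw [Ideal.mem_span_singleton'] at hu
  obtain ⟨a, ha⟩ := hu
  have ha' : (a : ℚ_[p]) * (p : ℚ_[p]) ^ N = (p : ℚ_[p]) ^ N * y - (u.appr N : ℚ_[p]) := by
    have h3 := congrArg (fun r : ℤ_[p] => (r : ℚ_[p])) ha
    simp only [PadicInt.coe_mul, PadicInt.coe_pow, PadicInt.coe_natCast, PadicInt.coe_sub] at h3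
    exact h3
  refine ⟨QmodZ.mk ((u.appr N : ℚ) / (p : ℚ) ^ N), ⟨N, ?_⟩, ?_⟩
  · rw [← map_nsmul, QmodZ.mk_eq_zero]
    refine ⟨u.appr N, ?_⟩
    rw [nsmul_eq_mul]
    push_cast
    field_simp
  · rw [proj_mk, ← sub_eq_zero, ← map_sub, QpModZp.mk_eq_zero]
    have : (((u.appr N : ℚ) / (p : ℚ) ^ N : ℚ) : ℚ_[p]) - y = -(a : ℚ_[p]) := by
      push_cast
      field_simp
      linear_combination ha'
    rw [this, norm_neg]
    exact a.2

/-- The inclusion `ℚ_p / ℤ_p ⊆ ℚ / ℤ` as the `p`-primary torsion: the value at `y` is the element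
of `ℚ / ℤ` that is killed by a power of `p` and projects to `y`. -/
def incl : QpModZp p →+ QmodZ :=
  AddMonoidHom.mk' (fun y => (exists_lift p y).choose) (fun y z => by
    obtain ⟨⟨N, hN⟩, h⟩ := (exists_lift p y).choose_spec
    obtain ⟨⟨M, hM⟩, h'⟩ := (exists_lift p z).choose_spec
    obtain ⟨⟨K, hK⟩, h''⟩ := (exists_lift p (y + z)).choose_spec
    rw [← sub_eq_zero]
    refine proj_injOn p _ (N + M + K) ?_ ?_
    · have e1 : p ^ (N + M + K) • (exists_lift p (y + z)).choose = 0 := by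
        rw [pow_add, mul_smul, hK, smul_zero]
      have e2 : p ^ (N + M + K) • (exists_lift p y).choose = 0 := by
        rw [show N + M + K = M + K + N by ring, pow_add, mul_smul, hN, smul_zero]
      have e3 : p ^ (N + M + K) • (exists_lift p z).choose = 0 := by
        rw [show N + M + K = N + K + M by ring, pow_add, mul_smul, hM, smul_zero]
      rw [smul_sub, smul_add, e1, e2, e3, add_zero, sub_zero]
    · rw [map_sub, map_add, h, h', h'', sub_self])

theorem proj_incl (y : QpModZp p) : proj p (incl p y) = y := (exists_lift p y).choose_spec.2

theorem incl_torsion (y : QpModZp p) : ∃ N : ℕ, p ^ N • incl p y = 0 :=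
  (exists_lift p y).choose_spec.1

/-- The class of `r / p ^ (m + 1)` in `ℚ_p / ℤ_p`; this is the identification of `ℤ / p ^ (m + 1)`
with the `p ^ (m + 1)`-torsion of `ℚ_p / ℤ_p`. -/
def frac (m : ℕ) : ℤ →+ QpModZp p :=
  (QpModZp.mk p).comp
    ((AddMonoidHom.mulRight ((p : ℚ_[p]) ^ (m + 1))⁻¹).comp (Int.castAddHom ℚ_[p]))

theorem frac_apply (m : ℕ) (r : ℤ) :
    frac p m r = QpModZp.mk p ((r : ℚ_[p]) / (p : ℚ_[p]) ^ (m + 1)) := rfl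

theorem frac_eq_zero (m : ℕ) (r : ℤ) : frac p m r = 0 ↔ ((p ^ (m + 1) : ℕ) : ℤ) ∣ r := by
  have hp0 : (0 : ℝ) < p := by exact_mod_cast (Fact.out : p.Prime).pos
  rw [frac_apply, QpModZp.mk_eq_zero]
  push_cast
  rw [← Padic.norm_int_le_pow_iff_dvd, norm_div, norm_pow, Padic.norm_p, zpow_neg,
    zpow_natCast, inv_pow, div_le_one (by positivity)]

end Coefficients

/-- The group `Hom^cont(G, A)` of continuous characters of `G` with values in `A`. -/
abbrev Char (G A : Type*) [Group G] [TopologicalSpace G] [AddCommGroup A] [TopologicalSpace A] :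
    Type _ :=
  Additive G →ₜ+ A

section ArtinSchreierWitt

variable {p : ℕ} [Fact p.Prime] {κ : Type*} [Field κ] {L : Type*} [Field L] [Algebra κ L]

/-- `χ` is the Artin–Schreier–Witt character of `x ∈ W_m(κ)`: for a solution `ν ∈ W_m(L)` of
`F(ν) - ν = x` the element `γ(ν) - ν` is the image of an integer `r`, and `χ(γ) = r / p ^ (m + 1)`
modulo `ℤ_p`. -/
def IsASW (m : ℕ) (x : W p m κ) (χ : Char Gal(L/κ) (QpModZp p)) : Prop :=
  ∃ ν : W p m L, frob ν - ν = mapW m (algebraMap κ L) x ∧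
    ∀ γ : Gal(L/κ), ∃ r : ℤ, mapW m (γ : L →+* L) ν - ν = (r : W p m L) ∧
      χ (Additive.ofMul γ) = frac p m r

theorem exists_solution [CharP L p] [IsSepClosed L] (m : ℕ) (x : W p m L) :
    ∃ ν : W p m L, frob ν - ν = x := by
  have hp2 : 2 ≤ p := (Fact.out : p.Prime).two_le
  have key : ∀ (n : ℕ) (w : WittVector p L), ∃ ν u : WittVector p L,
      w - (WittVector.frobenius ν - ν) = WittVector.verschiebung^[n] u := by
    intro n w
    induction n with
    | zero => exact ⟨0, w, by simp⟩
    | succ n ih =>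
      obtain ⟨ν, u, h⟩ := ih
      obtain ⟨a, ha⟩ := IsSepClosed.exists_root_C_mul_X_pow_add_C_mul_X_add_C' p p (1 : L) (-1)
        (-u.coeff 0) dvd_rfl hp2 (by simp)
      let t := WittVector.teichmuller p a
      have hc : ∀ i < 1, (u - (WittVector.frobenius t - t)).coeff i = 0 := by
        intro i hi
        obtain rfl : i = 0 := by omega
        have e : ∀ z : WittVector p L, z.coeff 0 = WittVector.constantCoeff z := fun _ => rfl
        rw [e, map_sub, map_sub, ← e, ← e, ← e, WittVector.coeff_frobenius_charP]
        simp only [t, WittVector.teichmuller_coeff_zero]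
        linear_combination -ha
      have hV := WittVector.eq_iterate_verschiebung hc
      refine ⟨ν + WittVector.verschiebung^[n] t,
        (u - (WittVector.frobenius t - t)).shift 1, ?_⟩
      · rw [Function.iterate_succ, Function.comp_apply]
        rw [Function.iterate_one] at hV
        rw [← hV]
        have hcomm : WittVector.frobenius (WittVector.verschiebung^[n] t) =
            WittVector.verschiebung^[n] (WittVector.frobenius t) :=
          ((WittVector.verschiebung_frobenius_comm (p := p) (R := L)).iterate_left n t).symm
        rw [iterate_map_sub, iterate_map_sub, ← h, map_add, hcomm]
        ring
  obtain ⟨w, rfl⟩ := WittVector.truncate_surjective p (m + 1) L x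
  obtain ⟨ν, u, h⟩ := key (m + 1) w
  refine ⟨WittVector.truncate (m + 1) ν, ?_⟩
  rw [frob_truncate, ← map_sub, eq_comm, ← sub_eq_zero, ← map_sub, h, ← RingHom.mem_ker,
    WittVector.mem_ker_truncate]
  intro i hi
  exact WittVector.iterate_verschiebung_coeff_eq_zero _ hi

theorem mapW_intCast {R S : Type*} [CommRing R] [CommRing S] {m : ℕ} (f : R →+* S) (r : ℤ) :
    mapW (p := p) m f (r : W p m R) = (r : W p m S) := map_intCast _ _

theorem exists_int_of_frob [CharP L p] (m : ℕ) (ν : W p m L) (h : frob ν = ν) :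
    ∃ r : ℤ, ν = (r : W p m L) := by
  have hc : ∀ l, ∃ a : ZMod p, ZMod.castHom (dvd_refl p) L a = ν.coeff l := by
    intro l
    have h1 : ν.coeff l ^ p = ν.coeff l := by
      conv_rhs => rw [← h]
      simp [frob]
    rw [← Subfield.mem_bot_iff_pow_eq_self L p, ← ZMod.fieldRange_castHom_eq_bot p] at h1
    exact h1
  choose a ha using hc
  let y : W p m (ZMod p) := TruncatedWittVector.mk p a
  have hy : mapW m (ZMod.castHom (dvd_refl p) L) y = ν := by
    ext l; rw [coeff_mapW, ← ha l]; simp [y]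
  obtain ⟨z, hz⟩ := (TruncatedWittVector.zmodEquivTrunc p (m + 1)).surjective y
  obtain ⟨r, rfl⟩ := ZMod.intCast_surjective z
  refine ⟨r, ?_⟩
  rw [← hy, ← hz, map_intCast, mapW_intCast]

theorem intCast_eq_zero_iff [CharP L p] (m : ℕ) (r : ℤ) :
    (r : W p m L) = 0 ↔ ((p ^ (m + 1) : ℕ) : ℤ) ∣ r := by
  rw [← mapW_intCast (ZMod.castHom (dvd_refl p) L) r,
    ← map_intCast (TruncatedWittVector.zmodEquivTrunc p (m + 1)) r]
  have hinj : Function.Injective (mapW (p := p) m (ZMod.castHom (dvd_refl p) L)) := by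
    intro x y hxy
    ext l
    have := congrArg (fun w => TruncatedWittVector.coeff l w) hxy
    simp only [coeff_mapW] at this
    exact (ZMod.castHom (dvd_refl p) L).injective this
  rw [map_eq_zero_iff _ hinj, map_eq_zero_iff _ (RingEquiv.injective _),
    ZMod.intCast_zmod_eq_zero_iff_dvd]

theorem frac_eq_of_intCast_eq [CharP L p] (m : ℕ) {r s : ℤ}
    (h : (r : W p m L) = (s : W p m L)) : frac p m r = frac p m s := by
  rw [← sub_eq_zero, ← map_sub, frac_eq_zero, ← intCast_eq_zero_iff (L := L), Int.cast_sub, h,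
    sub_self]

theorem frob_intCast [CharP L p] (m : ℕ) (r : ℤ) : frob (r : W p m L) = r := by
  have : (r : W p m L) = WittVector.truncate (m + 1) (r : WittVector p L) := by simp
  rw [this, frob_truncate, map_intCast]

theorem vMap_intCast [CharP L p] {i j : ℕ} (h : i ≤ j) (r : ℤ) :
    vMap i j h (r : W p i L) = ((r * (p : ℤ) ^ (j - i) : ℤ) : W p j L) := by
  have h0 : (r : W p i L) = WittVector.truncate (i + 1) (r : WittVector p L) := by simp
  have h1 : (r : WittVector p L) = WittVector.frobenius^[j - i] (r : WittVector p L) := by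
    have hf : Function.IsFixedPt (WittVector.frobenius (p := p)) (r : WittVector p L) :=
      map_intCast _ _
    exact (hf.iterate _).eq.symm
  rw [h0, vMap_truncate, h1]
  rw [WittVector.iterate_verschiebung_iterate_frobenius]
  simp

theorem frac_shift {i j : ℕ} (h : i ≤ j) (r : ℤ) :
    frac p j (r * (p : ℤ) ^ (j - i)) = frac p i r := by
  have hp0 : (p : ℚ_[p]) ≠ 0 := by exact_mod_cast (Fact.out : p.Prime).ne_zero
  obtain ⟨d, rfl⟩ := Nat.exists_eq_add_of_le h
  rw [frac_apply, frac_apply]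
  congr 1
  rw [Nat.add_sub_cancel_left]
  push_cast
  field_simp
  ring

theorem IsASW.unique [CharP L p] {m : ℕ} {x : W p m κ} {χ χ' : Char Gal(L/κ) (QpModZp p)}
    (h : IsASW m x χ) (h' : IsASW m x χ') : χ = χ' := by
  obtain ⟨ν, hν, hχ⟩ := h
  obtain ⟨ν', hν', hχ'⟩ := h'
  obtain ⟨c, hc⟩ := exists_int_of_frob m (ν - ν') (by
    rw [frob_sub]; linear_combination hν - hν')
  refine DFunLike.ext _ _ fun g => ?_
  obtain ⟨γ, rfl⟩ := Additive.ofMul.surjective g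
  obtain ⟨r, hr, e⟩ := hχ γ
  obtain ⟨s, hs, e'⟩ := hχ' γ
  rw [e, e']
  apply frac_eq_of_intCast_eq (L := L)
  have hν : ν = ν' + (c : W p m L) := by rw [← hc]; ring
  rw [← hr, ← hs, hν, map_add, mapW_intCast]
  ring

theorem IsASW.add [CharP κ p] [CharP L p] {m : ℕ} {x x' : W p m κ}
    {χ χ' : Char Gal(L/κ) (QpModZp p)} (h : IsASW m x χ) (h' : IsASW m x' χ') :
    IsASW m (x + x') (χ + χ') := by
  obtain ⟨ν, hν, hχ⟩ := h
  obtain ⟨ν', hν', hχ'⟩ := h'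
  refine ⟨ν + ν', ?_, fun γ => ?_⟩
  · rw [frob_add, map_add]; linear_combination hν + hν'
  · obtain ⟨r, hr, e⟩ := hχ γ
    obtain ⟨s, hs, e'⟩ := hχ' γ
    refine ⟨r + s, ?_, ?_⟩
    · rw [map_add, Int.cast_add]; linear_combination hr + hs
    · rw [map_add, ← e, ← e']; rfl

theorem IsASW.shift [CharP L p] {i j : ℕ} (hij : i ≤ j) {x : W p i κ}
    {χ : Char Gal(L/κ) (QpModZp p)} (h : IsASW i x χ) : IsASW j (vMap i j hij x) χ := by
  obtain ⟨ν, hν, hχ⟩ := h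
  refine ⟨vMap i j hij ν, ?_, fun γ => ?_⟩
  · rw [frob_vMap, ← map_sub, hν, mapW_vMap]
  · obtain ⟨r, hr, e⟩ := hχ γ
    refine ⟨r * (p : ℤ) ^ (j - i), ?_, ?_⟩
    · rw [mapW_vMap, ← map_sub, hr, vMap_intCast]
    · rw [e, frac_shift hij]

theorem exists_isASW [CharP L p] [IsSepClosure κ L] (m : ℕ) (x : W p m κ) :
    ∃ χ : Char Gal(L/κ) (QpModZp p), IsASW m x χ := by
  have : IsSepClosed L := IsSepClosure.sep_closed κ
  obtain ⟨ν, hν⟩ := exists_solution m (mapW m (algebraMap κ L) x)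
  have hr : ∀ γ : Gal(L/κ), ∃ r : ℤ, mapW m (γ : L →+* L) ν - ν = (r : W p m L) := by
    intro γ
    refine exists_int_of_frob m _ ?_
    have h1 : mapW m (γ : L →+* L) (mapW m (algebraMap κ L) x) = mapW m (algebraMap κ L) x := by
      ext l; simp
    rw [frob_sub, frob_mapW]
    rw [← hν, map_sub] at h1
    linear_combination h1
  choose r hr using hr
  let φ : Additive Gal(L/κ) →+ QpModZp p := AddMonoidHom.mk' (fun g => frac p m (r g.toMul)) (by
    intro g g'
    obtain ⟨γ, rfl⟩ := Additive.ofMul.surjective g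
    obtain ⟨γ', rfl⟩ := Additive.ofMul.surjective g'
    change frac p m (r (γ * γ')) = frac p m (r γ) + frac p m (r γ')
    rw [← map_add]
    apply frac_eq_of_intCast_eq (L := L)
    rw [Int.cast_add, ← hr, ← hr]
    have h2 : mapW m ((γ * γ' : Gal(L/κ)) : L →+* L) ν =
        mapW m (γ : L →+* L) (mapW m (γ' : L →+* L) ν) := by
      ext l; simp
    have h3 : mapW m (γ : L →+* L) (mapW m (γ' : L →+* L) ν - ν) = mapW m (γ' : L →+* L) ν - ν := by
      rw [hr γ', mapW_intCast]
    rw [map_sub] at h3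
    rw [h2]
    linear_combination h3 + hr γ')
  have hφ : Continuous φ := by
    refine continuous_of_continuousAt_zero φ ?_
    rw [ContinuousAt, map_zero, nhds_discrete (QpModZp p), Filter.tendsto_pure]
    have hU : ∀ l : Fin (m + 1), ∀ᶠ γ : Gal(L/κ) in nhds 1, γ (ν.coeff l) = ν.coeff l := by
      intro l
      exact (stabilizer_isOpen_of_isIntegral (K := κ) (ν.coeff l)).mem_nhds (one_mem _)
    have hU' : ∀ᶠ γ : Gal(L/κ) in nhds 1, φ (Additive.ofMul γ) = 0 := by
      filter_upwards [Filter.eventually_all.2 hU] with γ hγ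
      have h0 : ((r γ : ℤ) : W p m L) = ((0 : ℤ) : W p m L) := by
        rw [← hr γ, Int.cast_zero, sub_eq_zero]
        ext l
        simpa using hγ l
      exact (frac_eq_of_intCast_eq (L := L) m h0).trans (map_zero _)
    exact hU'
  exact ⟨⟨φ, hφ⟩, ν, hν, fun γ => ⟨r γ, hr γ, rfl⟩⟩

theorem charP_sep (p : ℕ) (κ L : Type*) [Field κ] [Field L] [Algebra κ L] [CharP κ p] : CharP L p := charP_of_injective_algebraMap (algebraMap κ L).injective p

variable (κ L) in
/-- The Artin–Schreier–Witt morphism on `W_m(κ)`: the value at `x` is the character `χ` with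
`IsASW m x χ`, which exists and is unique. -/
def deltaW [CharP κ p] [IsSepClosure κ L] (m : ℕ) : W p m κ →+ Char Gal(L/κ) (QpModZp p) :=
  haveI : CharP L p := charP_sep p κ L
  AddMonoidHom.mk' (fun x => (exists_isASW (L := L) m x).choose) (fun x y =>
    (exists_isASW m (x + y)).choose_spec.unique
      ((exists_isASW m x).choose_spec.add (exists_isASW m y).choose_spec))

theorem deltaW_spec [CharP κ p] [IsSepClosure κ L] (m : ℕ) (x : W p m κ) :
    IsASW m x (deltaW κ L m x) :=
  haveI : CharP L p := charP_sep p κ L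
  (exists_isASW (L := L) m x).choose_spec

variable (p κ L) in
/-- The Artin–Schreier–Witt morphism `δ : CW(κ) → Hom^cont(Gal(L/κ), ℚ_p / ℤ_p)`, where `L` is a
separable closure of `κ`. -/
def delta [CharP κ p] [IsSepClosure κ L] : CW p κ →+ Char Gal(L/κ) (QpModZp p) :=
  AddCommGroup.DirectLimit.lift _ _ _ (fun m => deltaW κ L m) (fun i j hij x => by
    have : CharP L p := charP_sep p κ L
    exact (deltaW_spec j (vMap i j hij x)).unique ((deltaW_spec i x).shift hij))

theorem delta_toCW [CharP κ p] [IsSepClosure κ L] (m : ℕ) (x : W p m κ) :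
    IsASW m x (delta p κ L (toCW p m κ x)) := by
  have h : delta p κ L (toCW p m κ x) = deltaW κ L m x :=
    AddCommGroup.DirectLimit.lift_of _ _ _ _ _
  rw [h]
  exact deltaW_spec m x

end ArtinSchreierWitt

section Kato

variable (p : ℕ) [Fact p.Prime] {k : Type*} [Field k]

open scoped LaurentSeries

instance [CharP k p] : CharP k⸨X⸩ p :=
  charP_of_injective_ringHom (f := (HahnSeries.C : k →+* k⸨X⸩)) HahnSeries.C_injective p

variable {p}

/-- The valuation `v(x_0, …, x_s) = min (p ^ s * v(x_0), p ^ (s - 1) * v(x_1), …, v(x_s))` on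
`W_s(k((t)))`, where `v` is the `t`-adic valuation on `k((t))`. -/
def val {s : ℕ} (x : W p s k⸨X⸩) : WithTop ℤ :=
  Finset.univ.inf fun i : Fin (s + 1) => p ^ (s - (i : ℕ)) • (x.coeff i).orderTop

variable (p k) in
/-- Kato's filtration on `CW(k((t)))`: the union of the images of the
`{x ∈ W_s(k((t))) | v(x) ≥ -d}`. -/
def filCW (d : ℕ) : Set (CW p k⸨X⸩) :=
  {f | ∃ (s : ℕ) (x : W p s k⸨X⸩), (((-(d : ℤ) : ℤ)) : WithTop ℤ) ≤ val x ∧ toCW p s k⸨X⸩ x = f}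

variable (Esep : Type*) [Field Esep] [Algebra k⸨X⸩ Esep] [IsSepClosure k⸨X⸩ Esep] [CharP k p]

variable (p k) in
/-- Kato's filtration on `Hom^cont(G_E, ℚ_p / ℤ_p)`: the image of the filtration on `CW(E)`. -/
def filChar (d : ℕ) : Set (Char Gal(Esep/k⸨X⸩) (QpModZp p)) :=
  delta p k⸨X⸩ Esep '' filCW p k d

variable {Esep}

/-- The composite of a character with a homomorphism of (discrete) coefficient groups. -/
def Char.push {G A B : Type*} [Group G] [TopologicalSpace G] [AddCommGroup A] [TopologicalSpace A]
    [DiscreteTopology A] [AddCommGroup B] [TopologicalSpace B] (f : A →+ B) (α : Char G A) :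
    Char G B where
  toAddMonoidHom := f.comp α.toAddMonoidHom
  continuous_toFun := (continuous_of_discreteTopology (f := f)).comp α.continuous_toFun

variable (p) in
/-- The arithmetic (Kato) Swan conductor of a character `α : G_E → ℚ / ℤ`: the least `d ≥ 0` such
that the `p`-part of `α` lies in the `d`-th step of Kato's filtration. -/
def sw (α : Char Gal(Esep/k⸨X⸩) QmodZ) : ℕ :=
  sInf {d : ℕ | Char.push (proj p) α ∈ filChar p k Esep d}

/-- The co-monomial `x t^(-d) = (…, 0, 0, x_0 t^(-n), x_1 t^(-np), …, x_m t^(-np^m)) ∈ CW(k((t)))`,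
`d = n p^m`, relative to `x = (x_0, …, x_m) ∈ W_m(k)`. -/
def comonomial {m : ℕ} (n : ℕ) (x : W p m k) : CW p k⸨X⸩ :=
  toCW p m k⸨X⸩ (TruncatedWittVector.mk p fun i =>
    HahnSeries.single (-((n * p ^ (i : ℕ) : ℕ) : ℤ)) (x.coeff i))

end Kato

end KatoSwan

end

noncomputable section

namespace KatoSwan

open WittVector

open scoped LaurentSeries

/-! ### Kernel of the Artin–Schreier–Witt morphism. -/

section ArtinSchreierWittKernel

variable {p : ℕ} [Fact p.Prime] {κ : Type*} [Field κ] {L : Type*} [Field L] [Algebra κ L]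

/-! Write `λ = p^j μ`. In characteristic `p` one has `p = VF`, so `λ t^(-np^m)` is `V^j F^j` of the
co-monomial of `μ` in level `M = m - j`. Neither `V` (trivial in the limit) nor `F` changes the
character, so everything reduces to a co-monomial `y t^(-np^M)` with `y` not divisible by `p`
(`delta_comonomial_p_pow_mul`). It visibly lies in step `np^M` of the filtration; the content is
that it lies in no smaller step.

Otherwise `Fw - w = V^s(y t^(-np^M)) - z` in `W_N(E)`, `N = M + s`, with `val z > -np^M`. Lift all
components to `W(k)((t))` by Teichmüller representatives of coefficients, let `φ` be the Frobenius
lift with `t ↦ t^p`, and take `N`-th ghost components: `p^s g_X - g_Z - (φ g_W - g_W)` has all its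
coefficients in `p^N V W(k)`. Here `VW(k)` replaces `pW(k)` because `k` need not be perfect.

The functional `twist`, taken over a long enough range, kills `φ g - g`. After `V^M`, the term `p^s
g_X` contributes `p^N Y` with `Y` lifting `y`, while Dwork's congruence makes `g_Z` contribute a
multiple of `p^(N+1)` (`pow_dvd_twist_teichLaurent_pow`). Dividing by `p^N` gives `F^T(Y - pQ) ∈
V^(M+1) W(k)`; since `F^T` raises components to the power `p^T`, this forces `p ∣ y`
(`p_dvd_of_frob_sub_eq`). -/

theorem IsASW.frob [CharP L p] {m : ℕ} {x : W p m κ} {χ : Char Gal(L/κ) (QpModZp p)}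
    (h : IsASW m x χ) : IsASW m (KatoSwan.frob x) χ := by
  obtain ⟨ν, hν, hχ⟩ := h
  refine ⟨KatoSwan.frob ν, ?_, fun γ => ?_⟩
  · rw [← frob_sub, hν, frob_mapW]
  · obtain ⟨r, hr, e⟩ := hχ γ
    exact ⟨r, by rw [← frob_mapW, ← frob_sub, hr, frob_intCast], e⟩

/-- For the zero character every `γ(ν) - ν` is an integer divisible by `p^(m+1)`, hence zero, so `ν`
is Galois-fixed and descends component by component. -/
theorem IsASW.exists_frob_sub_eq [CharP L p] [IsGalois κ L] {m : ℕ} {x : W p m κ}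
    (h : IsASW (L := L) m x 0) : ∃ w : W p m κ, KatoSwan.frob w - w = x := by
  obtain ⟨ν, hν, hχ⟩ := h
  have hfix : ∀ l, ∃ a : κ, algebraMap κ L a = ν.coeff l := by
    intro l
    refine (InfiniteGalois.mem_range_algebraMap_iff_fixed (ν.coeff l)).2 fun γ => ?_
    obtain ⟨r, hr, e⟩ := hχ γ
    have hr0 : (r : W p m L) = 0 := by
      rw [intCast_eq_zero_iff, ← frac_eq_zero, ← e]; rfl
    rw [hr0, sub_eq_zero] at hr
    simpa using congrArg (TruncatedWittVector.coeff l) hr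
  choose a ha using hfix
  have hinj : Function.Injective (mapW (p := p) m (algebraMap κ L)) := by
    intro x y hxy
    ext l
    simpa using congrArg (TruncatedWittVector.coeff l) hxy
  have hw : mapW m (algebraMap κ L) (TruncatedWittVector.mk p a) = ν := by
    ext l; simp [ha]
  refine ⟨TruncatedWittVector.mk p a, hinj ?_⟩
  rw [map_sub, ← frob_mapW, hw, hν]

theorem delta_toCW_frob [CharP κ p] [IsSepClosure κ L] (m : ℕ) (x : W p m κ) :
    delta p κ L (toCW p m κ (frob x)) = delta p κ L (toCW p m κ x) := by
  have : CharP L p := charP_sep p κ L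
  exact (delta_toCW m (frob x)).unique (delta_toCW m x).frob

theorem toCW_vMap {R : Type*} [CommRing R] {i j : ℕ} (h : i ≤ j) (x : W p i R) :
    toCW p j R (vMap i j h x) = toCW p i R x :=
  AddCommGroup.DirectLimit.of_f (G := fun m : ℕ => W p m R) (f := fun i j h => vMap i j h) h x

theorem exists_frob_sub_of_delta_eq [CharP κ p] [IsSepClosure κ L] {i j N : ℕ} (hi : i ≤ N)
    (hj : j ≤ N) {x : W p i κ} {y : W p j κ}
    (h : delta p κ L (toCW p i κ x) = delta p κ L (toCW p j κ y)) :
    ∃ w : W p N κ, frob w - w = vMap i N hi x - vMap j N hj y := by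
  have : CharP L p := charP_sep p κ L
  have : IsGalois κ L := IsSepClosure.isGalois
  refine IsASW.exists_frob_sub_eq (L := L) ?_
  have h0 : delta p κ L (toCW p N κ (vMap i N hi x - vMap j N hj y)) = 0 := by
    rw [map_sub, toCW_vMap, toCW_vMap, map_sub, h, sub_self]
  rw [← h0]
  exact delta_toCW N _

end ArtinSchreierWittKernel

/-! ### Laurent series: vanishing orders and `p`-th powers modulo `p`. -/

section Laurent

variable {R S : Type*} [CommRing R] [CommRing S]

/-- All coefficients of index less than `c` vanish. -/
def VanishesBelow (c : ℤ) (f : R⸨X⸩) : Prop := ∀ i < c, f.coeff i = 0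

theorem exists_vanishesBelow (f : R⸨X⸩) : ∃ c, VanishesBelow c f :=
  ⟨f.order, fun _ hi => HahnSeries.coeff_eq_zero_of_lt_order hi⟩

theorem VanishesBelow.mono {c d : ℤ} {f : R⸨X⸩} (hf : VanishesBelow c f) (h : d ≤ c) :
    VanishesBelow d f := fun i hi => hf i (by omega)

theorem VanishesBelow.add {c : ℤ} {f g : R⸨X⸩} (hf : VanishesBelow c f)
    (hg : VanishesBelow c g) : VanishesBelow c (f + g) := fun i hi => by
  rw [HahnSeries.coeff_add, hf i hi, hg i hi, add_zero]

theorem VanishesBelow.sub {c : ℤ} {f g : R⸨X⸩} (hf : VanishesBelow c f)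
    (hg : VanishesBelow c g) : VanishesBelow c (f - g) := fun i hi => by
  rw [HahnSeries.coeff_sub, hf i hi, hg i hi, sub_zero]

theorem VanishesBelow.mul {c d : ℤ} {f g : R⸨X⸩} (hf : VanishesBelow c f)
    (hg : VanishesBelow d g) : VanishesBelow (c + d) (f * g) := fun i hi => by
  rw [HahnSeries.coeff_mul]
  refine Finset.sum_eq_zero fun ij hij => ?_
  have h := (Finset.mem_antidiagonal.1 hij).2.2
  by_cases h1 : ij.1 < c
  · rw [hf _ h1, zero_mul]
  · rw [hg _ (by omega), mul_zero]

theorem VanishesBelow.pow {c : ℤ} {f : R⸨X⸩} (hf : VanishesBelow c f) (N : ℕ) :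
    VanishesBelow (N * c) (f ^ N) := by
  induction N with
  | zero =>
    intro i hi
    rw [pow_zero, HahnSeries.coeff_one, if_neg (by simp at hi; omega)]
  | succ N ih =>
    rw [pow_succ]
    exact (ih.mul hf).mono (by push_cast; linarith)

theorem VanishesBelow.pow_sub_pow {c v : ℤ} {f g : R⸨X⸩} (hf : VanishesBelow v f)
    (hg : VanishesBelow v g) (h : VanishesBelow c (f - g)) (N : ℕ) :
    VanishesBelow (c + N * v) (f ^ (N + 1) - g ^ (N + 1)) := by
  induction N with
  | zero => simpa using h
  | succ N ih =>
    have e : f ^ (N + 1 + 1) - g ^ (N + 1 + 1) =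
        f ^ (N + 1) * (f - g) + (f ^ (N + 1) - g ^ (N + 1)) * g := by ring
    rw [e]
    exact (((hf.pow (N + 1)).mul h).mono (by push_cast; linarith)).add
      ((ih.mul hg).mono (by push_cast; linarith))

theorem exists_sum_pow_prime_eq {ι A : Type*} [CommRing A] {p : ℕ} (hp : p.Prime) (s : Finset ι)
    (x : ι → A) : ∃ r, (∑ i ∈ s, x i) ^ p = ∑ i ∈ s, x i ^ p + p * r := by
  classical
  induction s using Finset.induction_on with
  | empty => exact ⟨0, by simp [hp.ne_zero]⟩
  | insert a s ha ih =>
    obtain ⟨r, hr⟩ := ih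
    obtain ⟨r', hr'⟩ := exists_add_pow_prime_eq hp (x a) (∑ i ∈ s, x i)
    refine ⟨r + r' * x a * ∑ i ∈ s, x i, ?_⟩
    rw [Finset.sum_insert ha, Finset.sum_insert ha, hr', hr]
    ring

theorem coeff_sum_single (s : Finset ℤ) (a : ℤ → R) (g : ℤ → ℤ) (i : ℤ) :
    (∑ ν ∈ s, HahnSeries.single (g ν) (a ν)).coeff i = ∑ ν ∈ s, if i = g ν then a ν else 0 := by
  rw [HahnSeries.coeff_sum]
  refine Finset.sum_congr rfl fun ν _ => ?_
  rw [HahnSeries.coeff_single]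
  split_ifs <;> rfl

/-- The congruence `(∑ x_i)^p ≡ ∑ x_i^p` modulo `p` holds for finite sums. A fixed coefficient of
`f^p` depends only on a finite truncation of `f`, so it carries over to Laurent series. -/
theorem dvd_coeff_pow_prime_sub {p : ℕ} (hp : p.Prime) (f : R⸨X⸩) (i : ℤ) :
    (p : R) ∣ (f ^ p).coeff i - if (p : ℤ) ∣ i then f.coeff (i / p) ^ p else 0 := by
  obtain ⟨v, hv⟩ := exists_vanishesBelow f
  -- The cutoff is large enough that `f^p - g^p`, which vanishes below `c + (p-1)v`, has no
  -- coefficient at `i`, and that `i / p < c` when `p ∣ i`.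
  set c : ℤ := |i| + 1 + |(p - 1 : ℕ) * v| with hc
  set g : R⸨X⸩ := ∑ ν ∈ Finset.Ico v c, HahnSeries.single ν (f.coeff ν) with hg
  have hgc : ∀ μ, g.coeff μ = if μ ∈ Finset.Ico v c then f.coeff μ else 0 := by
    intro μ
    rw [hg, coeff_sum_single, Finset.sum_ite_eq]
  have hgv : VanishesBelow v g := fun μ hμ => by
    rw [hgc, if_neg (by simp; omega)]
  have hfg : VanishesBelow c (f - g) := fun μ hμ => by
    rw [HahnSeries.coeff_sub, hgc]
    split_ifs with h
    · exact sub_self _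
    · rw [hv μ (by simp at h; omega), sub_zero]
  have hi : (f ^ p).coeff i = (g ^ p).coeff i := by
    have h := hv.pow_sub_pow hgv hfg (p - 1) i (by
      have h1 := le_abs_self i
      have h2 := neg_abs_le (((p - 1 : ℕ) : ℤ) * v)
      omega)
    rw [Nat.sub_add_cancel hp.one_le, HahnSeries.coeff_sub] at h
    exact sub_eq_zero.1 h
  obtain ⟨r, hr⟩ := exists_sum_pow_prime_eq hp (Finset.Ico v c)
    fun ν => HahnSeries.single ν (f.coeff ν)
  have hp0 : (p : ℤ) ≠ 0 := by exact_mod_cast hp.ne_zero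
  have hrc : ((p : R⸨X⸩) * r).coeff i = p * r.coeff i := by
    rw [← nsmul_eq_mul, HahnSeries.coeff_nsmul, Pi.smul_apply, nsmul_eq_mul]
  refine ⟨r.coeff i, ?_⟩
  rw [hi, hg, hr, HahnSeries.coeff_add, hrc]
  simp only [HahnSeries.single_pow]
  rw [coeff_sum_single _ (fun ν => f.coeff ν ^ p) (fun ν => p • ν)]
  have key : (∑ ν ∈ Finset.Ico v c, if i = p • ν then f.coeff ν ^ p else 0) =
      if (p : ℤ) ∣ i then f.coeff (i / p) ^ p else 0 := by
    split_ifs with h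
    · obtain ⟨μ, rfl⟩ := h
      rw [Int.mul_ediv_cancel_left _ hp0]
      have e : ∀ ν, (p : ℤ) * μ = p • ν ↔ μ = ν := by
        intro ν
        rw [nsmul_eq_mul, mul_right_inj' hp0]
      simp only [e, Finset.sum_ite_eq]
      split_ifs with h'
      · rfl
      · have hμ : μ < c := by
          have h1 := le_abs_self ((p : ℤ) * μ)
          have h2 := abs_nonneg (((p - 1 : ℕ) : ℤ) * v)
          have h3 : (1 : ℤ) ≤ p := by exact_mod_cast hp.one_le
          rcases le_or_gt μ 0 with h4 | h4
          · have := abs_nonneg ((p : ℤ) * μ)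
            omega
          · nlinarith
        rw [hv μ (by simp at h'; omega), zero_pow hp.ne_zero]
    · refine Finset.sum_eq_zero fun ν _ => if_neg fun e => h ⟨ν, ?_⟩
      rw [e, nsmul_eq_mul]
  rw [key]
  ring

/-- Applying a ring homomorphism to the coefficients of a Laurent series. -/
def mapLaurent (σ : R →+* S) : R⸨X⸩ →+* S⸨X⸩ where
  toFun f := HahnSeries.map f σ
  map_one' := HahnSeries.map_one σ.toMonoidWithZeroHom
  map_zero' := by ext; simp
  map_mul' _ _ := HahnSeries.map_mul σ.toNonUnitalRingHom
  map_add' _ _ := HahnSeries.map_add σ.toAddMonoidHom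

/-- The substitution `∑ a_i t ^ i ↦ ∑ a_i t ^ (q i)`. -/
def expand (q : ℕ) (hq : q ≠ 0) : R⸨X⸩ →+* R⸨X⸩ :=
  HahnSeries.embDomainRingHom (AddMonoidHom.mulLeft (q : ℤ))
    (fun _ _ h => mul_left_cancel₀ (Nat.cast_ne_zero.2 hq) h)
    (fun _ _ => mul_le_mul_iff_right₀ (by positivity))

theorem coeff_expand (q : ℕ) (hq : q ≠ 0) (f : R⸨X⸩) (i : ℤ) :
    (expand q hq f).coeff i = if (q : ℤ) ∣ i then f.coeff (i / q) else 0 := by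
  split_ifs with h
  · obtain ⟨j, rfl⟩ := h
    rw [Int.mul_ediv_cancel_left _ (Nat.cast_ne_zero.2 hq)]
    exact HahnSeries.embDomain_coeff
  · exact HahnSeries.embDomain_of_notMem_range fun ⟨j, hj⟩ => h ⟨j, hj.symm⟩

theorem frobenius_eq_expand_mapLaurent {p : ℕ} [Fact p.Prime] [CharP R p] (f : R⸨X⸩) :
    f ^ p = expand p (Fact.out : p.Prime).ne_zero (mapLaurent (frobenius R p) f) := by
  ext i
  have h := dvd_coeff_pow_prime_sub (Fact.out : p.Prime) f i
  rw [CharP.cast_eq_zero, zero_dvd_iff, sub_eq_zero] at h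
  rw [h, coeff_expand]
  rfl

end Laurent

/-! ### Frobenius lift and coefficientwise Teichmüller lifts on `W(k)((t))`. -/

section Dwork

set_option linter.unusedSectionVars false

variable {R : Type*} [CommRing R]

theorem coeff_natCast_mul (q : ℕ) (f : R⸨X⸩) (i : ℤ) :
    ((q : R⸨X⸩) * f).coeff i = q * f.coeff i := by
  rw [← nsmul_eq_mul, HahnSeries.coeff_nsmul, Pi.smul_apply, nsmul_eq_mul]

theorem natCast_dvd_of_dvd_coeff {q : ℕ} {f : R⸨X⸩} (h : ∀ i, (q : R) ∣ f.coeff i) :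
    (q : R⸨X⸩) ∣ f := by
  classical
  -- The chosen quotient must send `0` to `0`, so that applying it to the coefficients does not
  -- enlarge the support.
  let θ : R → R := fun x => if hx : x ≠ 0 ∧ (q : R) ∣ x then hx.2.choose else 0
  have hθ : ∀ x, (q : R) ∣ x → x = q * θ x := by
    intro x hx
    by_cases h0 : x = 0
    · simp [θ, h0]
    · have : x ≠ 0 ∧ (q : R) ∣ x := ⟨h0, hx⟩
      simp only [θ, dif_pos this]
      exact this.2.choose_spec
  refine ⟨HahnSeries.map f (⟨θ, by simp [θ]⟩ : ZeroHom R R), ?_⟩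
  ext i
  rw [coeff_natCast_mul]
  exact hθ _ (h i)

theorem VanishesBelow.natCast_mul {c : ℤ} {f : R⸨X⸩} (hf : VanishesBelow c f) (q : ℕ) :
    VanishesBelow c ((q : R⸨X⸩) * f) := fun i hi => by
  rw [coeff_natCast_mul, hf i hi, mul_zero]

variable {p : ℕ} [Fact p.Prime] {k : Type*} [Field k] [CharP k p]

variable (p k) in
/-- The Frobenius lift on `W(k)((t))` with `t ↦ t ^ p`. -/
def frobLaurent : (WittVector p k)⸨X⸩ →+* (WittVector p k)⸨X⸩ :=
  (expand p (Fact.out : p.Prime).ne_zero).comp (mapLaurent WittVector.frobenius)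

theorem coeff_frobLaurent (f : (WittVector p k)⸨X⸩) (i : ℤ) :
    (frobLaurent p k f).coeff i =
      if (p : ℤ) ∣ i then WittVector.frobenius (f.coeff (i / p)) else 0 :=
  coeff_expand p (Fact.out : p.Prime).ne_zero _ _

theorem VanishesBelow.frobLaurent {c : ℤ} {f : (WittVector p k)⸨X⸩} (hf : VanishesBelow c f) :
    VanishesBelow (p * c) (frobLaurent p k f) := by
  intro i hi
  rw [coeff_frobLaurent]
  split_ifs with h
  · obtain ⟨j, rfl⟩ := h
    have hp : (0 : ℤ) < p := by exact_mod_cast (Fact.out : p.Prime).pos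
    rw [Int.mul_ediv_cancel_left _ hp.ne', hf j (lt_of_mul_lt_mul_left hi hp.le), map_zero]
  · rfl

variable (p k) in
/-- The reduction `W(k)((t)) → k((t))`. -/
def redLaurent : (WittVector p k)⸨X⸩ →+* k⸨X⸩ := mapLaurent WittVector.constantCoeff

theorem coeff_redLaurent (f : (WittVector p k)⸨X⸩) (i : ℤ) :
    (redLaurent p k f).coeff i = (f.coeff i).coeff 0 := rfl

theorem redLaurent_frobLaurent (f : (WittVector p k)⸨X⸩) :
    redLaurent p k (frobLaurent p k f) = redLaurent p k f ^ p := by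
  rw [frobenius_eq_expand_mapLaurent]
  ext i
  rw [coeff_redLaurent, coeff_frobLaurent, coeff_expand]
  split_ifs
  · rw [coeff_frobenius_charP]; rfl
  · simp

/-- The coefficientwise Teichmüller lift. -/
def teichLaurent (p : ℕ) [Fact p.Prime] {k : Type*} [Field k] [CharP k p] (a : k⸨X⸩) :
    (WittVector p k)⸨X⸩ :=
  HahnSeries.map a (⟨teichmuller p, teichmuller_zero p⟩ : ZeroHom k (WittVector p k))

theorem coeff_teichLaurent (a : k⸨X⸩) (i : ℤ) :
    (teichLaurent p a).coeff i = teichmuller p (a.coeff i) := rfl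

theorem redLaurent_teichLaurent (a : k⸨X⸩) : redLaurent p k (teichLaurent p a) = a := by
  ext i
  rw [coeff_redLaurent, coeff_teichLaurent, teichmuller_coeff_zero]

theorem teichLaurent_zero : teichLaurent p (0 : k⸨X⸩) = 0 := by
  ext1; funext i
  rw [coeff_teichLaurent]
  simp

theorem VanishesBelow.teichLaurent {c : ℤ} {a : k⸨X⸩} (h : VanishesBelow c a) :
    VanishesBelow c (teichLaurent p a) := fun i hi => by
  rw [coeff_teichLaurent, h i hi, teichmuller_zero]

theorem teichLaurent_single (i : ℤ) (c : k) :
    teichLaurent p (HahnSeries.single i c) = HahnSeries.single i (teichmuller p c) :=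
  HahnSeries.map_single _

theorem frobenius_teichmuller (c : k) :
    WittVector.frobenius (teichmuller p c) = teichmuller p c ^ p := by
  rw [frobenius_eq_map_frobenius, map_teichmuller, frobenius_def, map_pow]

/-- On Teichmüller coefficients `F` is the `p`-th power, so the Frobenius lift is exactly the series
that the `p`-th power is congruent to modulo `p`. -/
theorem dvd_teichLaurent_pow_sub (a : k⸨X⸩) :
    (p : (WittVector p k)⸨X⸩) ∣ teichLaurent p a ^ p - frobLaurent p k (teichLaurent p a) := by
  refine natCast_dvd_of_dvd_coeff fun i => ?_
  have h := dvd_coeff_pow_prime_sub (Fact.out : p.Prime) (teichLaurent p a) i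
  rw [HahnSeries.coeff_sub, coeff_frobLaurent, coeff_teichLaurent, frobenius_teichmuller]
  exact h

/-- Dwork's congruence: raising a congruence modulo `p` to the power `p^l` improves it to one modulo
`p^(l+1)`. -/
theorem exists_teichLaurent_pow_eq (a : k⸨X⸩) (l : ℕ) : ∃ h : (WittVector p k)⸨X⸩,
    teichLaurent p a ^ p ^ (l + 1) =
      frobLaurent p k (teichLaurent p a ^ p ^ l) + ((p ^ (l + 1) : ℕ) : (WittVector p k)⸨X⸩) * h := by
  obtain ⟨h, hh⟩ := dvd_sub_pow_of_dvd_sub (dvd_teichLaurent_pow_sub (p := p) a) l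
  refine ⟨h, ?_⟩
  rw [map_pow, pow_succ', pow_mul]
  push_cast
  linear_combination hh

theorem natCast_p_pow_ne_zero (e : ℕ) : ((p ^ e : ℕ) : WittVector p k) ≠ 0 := by
  push_cast
  exact pow_ne_zero _ (WittVector.p_nonzero p k)

/-- `W(k)` is a domain with `p ≠ 0`. This bounds the pole of the error term in Dwork's congruence.
-/
theorem VanishesBelow.of_natCast_mul {c : ℤ} {f : (WittVector p k)⸨X⸩} {e : ℕ}
    (h : VanishesBelow c (((p ^ e : ℕ) : (WittVector p k)⸨X⸩) * f)) : VanishesBelow c f := by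
  intro i hi
  have := h i hi
  rw [coeff_natCast_mul] at this
  exact (mul_eq_zero.1 this).resolve_left (natCast_p_pow_ne_zero e)

/-! ### The twisted principal part along the exponents `-np^r`. -/

/-- The functional `f ↦ ∑_{r ≤ M} F ^ (M - r) (f_{-n p ^ r})` on `W(k)((t))`. -/
def twist (p : ℕ) [Fact p.Prime] (k : Type*) [Field k] (n : ℕ) :
    ℕ → ((WittVector p k)⸨X⸩ →+ WittVector p k)
  | 0 => AddMonoidHom.mk' (fun f => f.coeff (-(n : ℤ))) fun _ _ => rfl
  | M + 1 => (WittVector.frobenius : WittVector p k →+* WittVector p k).toAddMonoidHom.comp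
      (twist p k n M) +
      AddMonoidHom.mk' (fun f => f.coeff (-((n * p ^ (M + 1) : ℕ) : ℤ))) fun _ _ => rfl

theorem twist_zero (n : ℕ) (f : (WittVector p k)⸨X⸩) :
    twist p k n 0 f = f.coeff (-(n : ℤ)) := rfl

theorem twist_succ (n M : ℕ) (f : (WittVector p k)⸨X⸩) :
    twist p k n (M + 1) f =
      WittVector.frobenius (twist p k n M f) + f.coeff (-((n * p ^ (M + 1) : ℕ) : ℤ)) := rfl

theorem twist_natCast_mul (n M q : ℕ) (f : (WittVector p k)⸨X⸩) :
    twist p k n M ((q : (WittVector p k)⸨X⸩) * f) = q * twist p k n M f := by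
  rw [← nsmul_eq_mul, map_nsmul, nsmul_eq_mul]

/-- The Frobenius lift moves the coefficient at `-np^r` to `-np^(r+1)` and applies `F`. Nothing
arrives at `-n`, because `p` does not divide `n`. -/
theorem twist_succ_frobLaurent {n : ℕ} (hn : n.Coprime p) (M : ℕ) (f : (WittVector p k)⸨X⸩) :
    twist p k n (M + 1) (frobLaurent p k f) = WittVector.frobenius (twist p k n M f) := by
  have hp : (p : ℤ) ≠ 0 := by exact_mod_cast (Fact.out : p.Prime).ne_zero
  have hc : ∀ M, (frobLaurent p k f).coeff (-((n * p ^ (M + 1) : ℕ) : ℤ)) =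
      WittVector.frobenius (f.coeff (-((n * p ^ M : ℕ) : ℤ))) := by
    intro M
    have e : -((n * p ^ (M + 1) : ℕ) : ℤ) = p * -((n * p ^ M : ℕ) : ℤ) := by push_cast; ring
    rw [e, coeff_frobLaurent, if_pos (dvd_mul_right _ _), Int.mul_ediv_cancel_left _ hp]
  induction M with
  | zero =>
    have h0 : ¬ (p : ℤ) ∣ -(n : ℤ) := by
      rw [dvd_neg, Int.natCast_dvd_natCast]
      exact fun h => (Fact.out : p.Prime).one_lt.ne' (Nat.Coprime.eq_one_of_dvd hn.symm h)
    rw [twist_succ, hc, twist_zero, twist_zero, coeff_frobLaurent, if_neg h0]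
    simp
  | succ M ih => rw [twist_succ, ih, hc, twist_succ, map_add]

theorem twist_add_of_coeff_eq_zero {n M : ℕ} {f : (WittVector p k)⸨X⸩}
    (h : ∀ r, M < r → f.coeff (-((n * p ^ r : ℕ) : ℤ)) = 0) (T : ℕ) :
    twist p k n (M + T) f = WittVector.frobenius^[T] (twist p k n M f) := by
  induction T with
  | zero => rfl
  | succ T ih =>
    rw [← add_assoc, twist_succ, ih, h _ (by omega), add_zero, Function.iterate_succ_apply']

theorem VanishesBelow.coeff_neg_eq_zero {n M r : ℕ} {c : ℤ} {f : (WittVector p k)⸨X⸩}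
    (hf : VanishesBelow c f) (hc : -((n * p ^ M : ℕ) : ℤ) < c) (h : M ≤ r) :
    f.coeff (-((n * p ^ r : ℕ) : ℤ)) = 0 := by
  refine hf _ (lt_of_le_of_lt (neg_le_neg ?_) hc)
  exact_mod_cast Nat.mul_le_mul_left _ (Nat.pow_le_pow_right (Fact.out : p.Prime).pos h)

theorem iterate_verschiebung_natCast_mul (M q : ℕ) (x : WittVector p k) :
    verschiebung^[M] ((q : WittVector p k) * x) = q * verschiebung^[M] x := by
  rw [← nsmul_eq_mul, iterate_map_nsmul, nsmul_eq_mul]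

theorem iterate_verschiebung_succ_frobenius (M : ℕ) (x : WittVector p k) :
    verschiebung^[M + 1] (WittVector.frobenius x) = (p : WittVector p k) * verschiebung^[M] x := by
  rw [Function.iterate_succ_apply, verschiebung_frobenius, mul_comm,
    iterate_verschiebung_natCast_mul]

/-- Induction on `l` by Dwork's congruence: its Frobenius term lowers both `l` and `M` by one and
gains a factor `p` from `V^(M+1) F = p V^M`. Its error term already carries `p^(l+1)`, and gains one
more `p` because its coefficient at the last exponent vanishes. -/
theorem pow_dvd_twist_teichLaurent_pow {n : ℕ} (hn : n.Coprime p) (a : k⸨X⸩) {v : ℤ}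
    (hv : VanishesBelow v a) (M l : ℕ) (h : -((n * p ^ M : ℕ) : ℤ) < p ^ l * v) :
    ((p ^ (l + 1) : ℕ) : WittVector p k) ∣
      verschiebung^[M] (twist p k n M (teichLaurent p a ^ p ^ l)) := by
  have hpow : ∀ l, VanishesBelow ((p : ℤ) ^ l * v) (teichLaurent p a ^ p ^ l) := by
    intro l
    have := hv.teichLaurent (p := p) |>.pow (p ^ l)
    push_cast at this
    exact this
  have hp : (0 : ℤ) < p := by exact_mod_cast (Fact.out : p.Prime).pos
  induction l generalizing M with
  | zero =>
    cases M with
    | zero =>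
      have h0 := (hpow 0).coeff_neg_eq_zero h le_rfl
      simp only [pow_zero, mul_one] at h0
      rw [twist_zero, pow_zero, h0]
      simp
    | succ M =>
      -- The pole bound removes the last coefficient, so the twist is a value of `F`, and `V^(M+1) F
      -- = p V^M` supplies the factor `p`.
      rw [twist_succ, (hpow 0).coeff_neg_eq_zero h le_rfl, add_zero,
        iterate_verschiebung_succ_frobenius]
      simp
  | succ l ih =>
    cases M with
    | zero =>
      have h0 := (hpow (l + 1)).coeff_neg_eq_zero h le_rfl
      simp only [pow_zero, mul_one] at h0
      rw [twist_zero, h0]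
      simp
    | succ M =>
      obtain ⟨g, hg⟩ := exists_teichLaurent_pow_eq (p := p) a l
      have hgv : VanishesBelow ((p : ℤ) ^ (l + 1) * v) g := by
        refine VanishesBelow.of_natCast_mul (e := l + 1) ?_
        have e : ((p ^ (l + 1) : ℕ) : (WittVector p k)⸨X⸩) * g =
            teichLaurent p a ^ p ^ (l + 1) - frobLaurent p k (teichLaurent p a ^ p ^ l) := by
          rw [hg]; ring
        rw [e]
        exact (hpow (l + 1)).sub ((hpow l).frobLaurent.mono (by rw [pow_succ']; linarith))
      -- The strict inequality for `(M + 1, l + 1)` is `p` times the one for `(M, l)`, so the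
      -- induction hypothesis applies.
      have hlt : -((n * p ^ M : ℕ) : ℤ) < p ^ l * v := by
        push_cast at h ⊢
        refine lt_of_mul_lt_mul_left (a := (p : ℤ)) ?_ hp.le
        calc (p : ℤ) * -(n * p ^ M) = -(n * p ^ (M + 1)) := by ring
          _ < p ^ (l + 1) * v := h
          _ = p * (p ^ l * v) := by ring
      obtain ⟨q, hq⟩ := ih M hlt
      rw [hg, map_add, twist_succ_frobLaurent hn, twist_natCast_mul, iterate_map_add,
        iterate_verschiebung_succ_frobenius, hq, iterate_verschiebung_natCast_mul, twist_succ,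
        hgv.coeff_neg_eq_zero h le_rfl, add_zero, iterate_verschiebung_succ_frobenius]
      refine ⟨q + verschiebung^[M] (twist p k n M g), ?_⟩
      push_cast
      ring

theorem twist_single {n : ℕ} (hn : 0 < n) (M : ℕ) (c : WittVector p k) :
    twist p k n M (HahnSeries.single (-((n * p ^ M : ℕ) : ℤ)) c) = c := by
  have hne : ∀ {r : ℕ}, r < M → (HahnSeries.single (-((n * p ^ M : ℕ) : ℤ)) c).coeff
      (-((n * p ^ r : ℕ) : ℤ)) = 0 := by
    intro r hr
    refine HahnSeries.coeff_single_of_ne fun e => ?_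
    have := Nat.mul_lt_mul_of_pos_left (Nat.pow_lt_pow_right (Fact.out : p.Prime).one_lt hr) hn
    have e' := neg_injective e
    norm_cast at e'
    omega
  have h0 : ∀ r < M, twist p k n r (HahnSeries.single (-((n * p ^ M : ℕ) : ℤ)) c) = 0 := by
    intro r
    induction r with
    | zero =>
      intro hr
      have := hne hr
      simp only [pow_zero, mul_one] at this
      exact this
    | succ r ih =>
      intro hr
      rw [twist_succ, ih (by omega), hne hr, map_zero, add_zero]
  cases M with
  | zero =>
    rw [twist_zero, pow_zero, mul_one]
    exact HahnSeries.coeff_single_same _ _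
  | succ M =>
    rw [twist_succ, h0 M (by omega), map_zero, zero_add]
    exact HahnSeries.coeff_single_same _ _

/-! ### The ideals `p^e V W(k)` and ghost components of Witt vectors reducing to zero. -/

/-- All coefficients lie in `p ^ e V W(k)`. -/
def VDivisible (e : ℕ) (f : (WittVector p k)⸨X⸩) : Prop :=
  ∀ i, ∃ c, f.coeff i = (p : WittVector p k) ^ e * verschiebung c

theorem exists_sum_eq_pow_mul_verschiebung {ι : Type*} (e : ℕ) (s : Finset ι)
    (x : ι → WittVector p k) (h : ∀ i ∈ s, ∃ c, x i = (p : WittVector p k) ^ e * verschiebung c) :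
    ∃ c, ∑ i ∈ s, x i = (p : WittVector p k) ^ e * verschiebung c := by
  classical
  choose! c hc using h
  refine ⟨∑ i ∈ s, c i, ?_⟩
  rw [map_sum, Finset.mul_sum]
  exact Finset.sum_congr rfl hc

theorem VDivisible.sum {ι : Type*} {e : ℕ} {s : Finset ι} {f : ι → (WittVector p k)⸨X⸩}
    (h : ∀ i ∈ s, VDivisible e (f i)) : VDivisible e (∑ i ∈ s, f i) := fun i => by
  rw [HahnSeries.coeff_sum]
  exact exists_sum_eq_pow_mul_verschiebung e s _ fun j hj => h j hj i

theorem VDivisible.mul_left {e : ℕ} {f : (WittVector p k)⸨X⸩} (h : VDivisible e f)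
    (g : (WittVector p k)⸨X⸩) : VDivisible e (f * g) := fun i => by
  rw [HahnSeries.coeff_mul]
  refine exists_sum_eq_pow_mul_verschiebung e _ _ fun ij _ => ?_
  obtain ⟨c, hc⟩ := h ij.1
  refine ⟨c * WittVector.frobenius (g.coeff ij.2), ?_⟩
  rw [verschiebung_mul_frobenius, hc, mul_assoc]

theorem verschiebung_mul_verschiebung (x y : WittVector p k) :
    verschiebung x * verschiebung y = (p : WittVector p k) * verschiebung (x * y) := by
  rw [← verschiebung_mul_frobenius, frobenius_verschiebung, ← mul_assoc,
    mul_comm (x * y), ← nsmul_eq_mul, map_nsmul, nsmul_eq_mul]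

/-- Since `Vx · Vy = p V(xy)`, each further factor from `VW(k)` gains a `p`. This recovers, over
imperfect `k`, the divisibility that powers of `p` would give. -/
theorem VDivisible.mul {e : ℕ} {u f : (WittVector p k)⸨X⸩} (hu : VDivisible 0 u)
    (h : VDivisible e f) : VDivisible (e + 1) (u * f) := fun i => by
  rw [HahnSeries.coeff_mul]
  refine exists_sum_eq_pow_mul_verschiebung (e + 1) _ _ fun ij _ => ?_
  obtain ⟨c, hc⟩ := hu ij.1
  obtain ⟨d, hd⟩ := h ij.2
  refine ⟨c * d, ?_⟩
  rw [hc, hd]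
  linear_combination (p : WittVector p k) ^ e * verschiebung_mul_verschiebung c d

theorem VDivisible.pow_succ {u : (WittVector p k)⸨X⸩} (hu : VDivisible 0 u) (e : ℕ) :
    VDivisible e (u ^ (e + 1)) := by
  induction e with
  | zero => simpa using hu
  | succ e ih => rw [_root_.pow_succ']; exact hu.mul ih

theorem VDivisible.pow_pow {u : (WittVector p k)⸨X⸩} (hu : VDivisible 0 u) (e : ℕ) :
    VDivisible e (u ^ p ^ e) := by
  have h : e + 1 ≤ p ^ e := Nat.lt_pow_self (Fact.out : p.Prime).one_lt
  rw [← Nat.add_sub_cancel' h, pow_add]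
  exact (hu.pow_succ e).mul_left _

theorem VDivisible.p_pow_mul {e : ℕ} {f : (WittVector p k)⸨X⸩} (h : VDivisible e f) (i : ℕ) :
    VDivisible (i + e) ((p : (WittVector p k)⸨X⸩) ^ i * f) := fun j => by
  obtain ⟨c, hc⟩ := h j
  refine ⟨c, ?_⟩
  have := coeff_natCast_mul (p ^ i) f j
  push_cast at this
  rw [this, hc, pow_add, mul_assoc]

theorem ghostComponent_eq_sum {A : Type*} [CommRing A] (s : ℕ) (x : WittVector p A) :
    ghostComponent s x = ∑ i ∈ Finset.range (s + 1), (p : A) ^ i * x.coeff i ^ p ^ (s - i) := by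
  rw [ghostComponent_apply, aeval_wittPolynomial]

theorem ghostComponent_map {A B : Type*} [CommRing A] [CommRing B] (g : A →+* B) (s : ℕ)
    (x : WittVector p A) : ghostComponent s (WittVector.map g x) = g (ghostComponent s x) := by
  rw [ghostComponent_eq_sum, ghostComponent_eq_sum, map_sum]
  simp

/-- In the term `p^i u_i^(p^(s-i))` the power contributes `s - i` factors `p` and one `V`, because
`p^(s-i) ≥ s - i + 1`. -/
theorem vDivisible_ghostComponent {s : ℕ} {u : WittVector p (WittVector p k)⸨X⸩}
    (h : ∀ i ≤ s, VDivisible 0 (u.coeff i)) : VDivisible s (ghostComponent s u) := by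
  rw [ghostComponent_eq_sum]
  refine VDivisible.sum fun i hi => ?_
  have hi' : i ≤ s := by simpa [Nat.lt_succ_iff] using hi
  have := ((h i hi').pow_pow (s - i)).p_pow_mul i
  rwa [Nat.add_sub_cancel' hi'] at this

theorem vDivisible_zero_of_redLaurent_eq_zero {f : (WittVector p k)⸨X⸩}
    (h : redLaurent p k f = 0) : VDivisible 0 f := fun i => by
  have h0 : (f.coeff i).coeff 0 = 0 := by
    rw [← coeff_redLaurent, h]; rfl
  refine ⟨(f.coeff i).shift 1, ?_⟩
  have := eq_iterate_verschiebung (x := f.coeff i) (n := 1) (by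
    intro j hj; obtain rfl : j = 0 := by omega
    exact h0)
  rw [pow_zero, one_mul]
  exact this

/-- In characteristic `p`, `F` and `V` commute, so the iterated `F` in the functional preserves `p^e
V W(k)`. -/
theorem VDivisible.exists_twist_eq {e : ℕ} {f : (WittVector p k)⸨X⸩} (h : VDivisible e f)
    (n M : ℕ) : ∃ c, twist p k n M f = ((p ^ e : ℕ) : WittVector p k) * verschiebung c := by
  push_cast
  induction M with
  | zero => exact h _
  | succ M ih =>
    obtain ⟨c, hc⟩ := ih
    obtain ⟨d, hd⟩ := h (-((n * p ^ (M + 1) : ℕ) : ℤ))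
    refine ⟨WittVector.frobenius c + d, ?_⟩
    rw [twist_succ, hc, hd, map_add, map_mul, map_pow, map_natCast,
      ← verschiebung_frobenius_comm c, mul_add]

end Dwork

/-! ### The lower bound: comparing a co-monomial with a Witt vector of smaller pole. -/

section LowerBound

set_option linter.unusedSectionVars false

variable {p : ℕ} [Fact p.Prime] {k : Type*} [Field k] [CharP k p]

/-- The zero series is a separate case because its `order` has the default value `0`, while its
`orderTop` is `⊤`. -/
theorem coe_le_nsmul_orderTop_iff {q : ℕ} (hq : q ≠ 0) (c : ℤ) (a : k⸨X⸩) :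
    ((c : ℤ) : WithTop ℤ) ≤ q • a.orderTop ↔ a = 0 ∨ c ≤ q * a.order := by
  by_cases ha : a = 0
  · obtain ⟨q, rfl⟩ := Nat.exists_eq_succ_of_ne_zero hq
    simp [ha, succ_nsmul]
  · rw [← HahnSeries.order_eq_orderTop_of_ne_zero ha, ← WithTop.coe_nsmul, WithTop.coe_le_coe,
      nsmul_eq_mul]
    simp [ha]

theorem coe_le_val_iff {s : ℕ} (x : W p s k⸨X⸩) (c : ℤ) : (c : WithTop ℤ) ≤ val x ↔
    ∀ i : Fin (s + 1), x.coeff i = 0 ∨ c ≤ (p : ℤ) ^ (s - (i : ℕ)) * (x.coeff i).order := by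
  rw [val, Finset.le_inf_iff]
  refine ⟨fun h i => ?_, fun h i _ => ?_⟩
  · have := h i (Finset.mem_univ i)
    rw [coe_le_nsmul_orderTop_iff (pow_ne_zero _ (Fact.out : p.Prime).ne_zero)] at this
    exact_mod_cast this
  · rw [coe_le_nsmul_orderTop_iff (pow_ne_zero _ (Fact.out : p.Prime).ne_zero)]
    exact_mod_cast h i

theorem coeff_vMap {R : Type*} [CommRing R] {i j : ℕ} (h : i ≤ j) (x : W p i R)
    (l : Fin (j + 1)) : (vMap i j h x).coeff l =
      if (l : ℕ) < j - i then 0 else x.coeff ⟨(l : ℕ) - (j - i), by have := l.2; omega⟩ :=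
  TruncatedWittVector.coeff_mk _ _

theorem coe_le_val_vMap {i j : ℕ} (h : i ≤ j) {x : W p i k⸨X⸩} {c : ℤ}
    (hx : (c : WithTop ℤ) ≤ val x) : (c : WithTop ℤ) ≤ val (vMap i j h x) := by
  rw [coe_le_val_iff] at hx ⊢
  intro l
  rw [coeff_vMap]
  split_ifs with hl
  · exact Or.inl rfl
  · have := hx ⟨(l : ℕ) - (j - i), by have := l.2; omega⟩
    have e : i - ((l : ℕ) - (j - i)) = j - (l : ℕ) := by have := l.2; omega
    rwa [e] at this

/-- The Witt vector `(x_0 t ^ (-n), x_1 t ^ (-n p), …, x_m t ^ (-n p ^ m))`. -/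
def monomial {m : ℕ} (n : ℕ) (x : W p m k) : W p m k⸨X⸩ :=
  TruncatedWittVector.mk p fun i =>
    HahnSeries.single (-((n * p ^ (i : ℕ) : ℕ) : ℤ)) (x.coeff i)

theorem comonomial_eq {m : ℕ} (n : ℕ) (x : W p m k) :
    comonomial n x = toCW p m k⸨X⸩ (monomial n x) := rfl

theorem coeff_monomial {m : ℕ} (n : ℕ) (x : W p m k) (i : Fin (m + 1)) :
    (monomial n x).coeff i = HahnSeries.single (-((n * p ^ (i : ℕ) : ℕ) : ℤ)) (x.coeff i) :=
  TruncatedWittVector.coeff_mk _ _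

theorem le_val_monomial {m : ℕ} (n : ℕ) (x : W p m k) :
    ((-((n * p ^ m : ℕ) : ℤ) : ℤ) : WithTop ℤ) ≤ val (monomial n x) := by
  rw [coe_le_val_iff]
  intro i
  rw [coeff_monomial]
  by_cases h : x.coeff i = 0
  · left; rw [h, map_zero]
  · right
    rw [HahnSeries.order_single h]
    have e : p ^ m = p ^ (m - (i : ℕ)) * p ^ (i : ℕ) := by
      rw [← pow_add, Nat.sub_add_cancel (by have := i.2; omega)]
    rw [e]
    push_cast
    apply le_of_eq
    ring

/-- The componentwise lift of a truncated Witt vector over `k((t))` to `W(W(k)((t)))`. -/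
def teichLift {N : ℕ} (x : W p N k⸨X⸩) : WittVector p (WittVector p k)⸨X⸩ :=
  WittVector.mk p fun i => teichLaurent p (x.out.coeff i)

theorem coeff_teichLift {N : ℕ} (x : W p N k⸨X⸩) (i : Fin (N + 1)) :
    (teichLift x).coeff i = teichLaurent p (x.coeff i) := by
  rw [← TruncatedWittVector.coeff_out]; rfl

theorem truncate_map_teichLift {N : ℕ} (x : W p N k⸨X⸩) :
    WittVector.truncate (N + 1) (WittVector.map (redLaurent p k) (teichLift x)) = x := by
  ext i
  rw [WittVector.coeff_truncate, WittVector.map_coeff, coeff_teichLift, redLaurent_teichLaurent]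

theorem coeff_sum_iterate_verschiebung_teichmuller (y : ℕ → k) (N n : ℕ) :
    (∑ i ∈ Finset.range N, verschiebung^[i] (teichmuller p (y i))).coeff n =
      if n < N then y n else 0 := by
  have hv : ∀ N n, (verschiebung^[N] (teichmuller p (y N))).coeff n =
      if n = N then y N else 0 := by
    intro N n
    rcases lt_trichotomy n N with h | rfl | h
    · rw [iterate_verschiebung_coeff_eq_zero _ h, if_neg h.ne]
    · have := iterate_verschiebung_coeff (teichmuller p (y n)) n 0
      rw [zero_add] at this
      rw [this, if_pos rfl, teichmuller_coeff_zero]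
    · obtain ⟨e, rfl⟩ := Nat.exists_eq_add_of_lt h
      rw [show N + e + 1 = (e + 1) + N by ring, iterate_verschiebung_coeff,
        teichmuller_coeff_pos _ _ _ (by omega), if_neg (by omega)]
  induction N generalizing n with
  | zero => simp
  | succ N ih =>
    rw [Finset.sum_range_succ, coeff_add_of_disjoint, ih, hv]
    · rcases lt_trichotomy n N with h | rfl | h
      · simp [h, h.ne, Nat.lt_succ_of_lt h]
      · simp
      · simp [h.ne', show ¬ n < N by omega, show ¬ n < N + 1 by omega]
    · intro l
      rw [ih, hv]
      by_cases h : l = N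
      · left; simp [h]
      · right; simp [h]

/-- The power of `[c]` is `F^(M-i)[c]`, and `V^(M-i) F^(M-i)` is multiplication by `p^(M-i)`; the
remaining `V^i` survives. -/
theorem p_pow_mul_iterate_verschiebung_teichmuller_pow (M i : ℕ) (hi : i ≤ M) (c : k) :
    ((p ^ i : ℕ) : WittVector p k) * verschiebung^[M] (teichmuller p c ^ p ^ (M - i)) =
      ((p ^ M : ℕ) : WittVector p k) * verschiebung^[i] (teichmuller p c) := by
  have h1 : ∀ e, teichmuller p c ^ p ^ e = WittVector.frobenius^[e] (teichmuller p c) := by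
    intro e
    induction e with
    | zero => simp
    | succ e ih =>
      rw [Function.iterate_succ_apply', ← ih, map_pow, frobenius_teichmuller, ← pow_mul, pow_succ']
  obtain ⟨e, rfl⟩ := Nat.exists_eq_add_of_le hi
  rw [Nat.add_sub_cancel_left, h1, Function.iterate_add_apply,
    iterate_verschiebung_iterate_frobenius, mul_comm (teichmuller p c)]
  have := iterate_verschiebung_natCast_mul i (p ^ e) (teichmuller p c)
  push_cast at this ⊢
  rw [this, pow_add, mul_assoc]

theorem iterate_verschiebung_sum {ι : Type*} (M : ℕ) (s : Finset ι) (x : ι → WittVector p k) :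
    verschiebung^[M] (∑ i ∈ s, x i) = ∑ i ∈ s, verschiebung^[M] (x i) := by
  induction M with
  | zero => rfl
  | succ M ih => simp only [Function.iterate_succ_apply', ih, map_sum]

theorem ghostComponent_teichLift_monomial {M n : ℕ} (y : W p M k) :
    ghostComponent M (teichLift (monomial n y)) =
      HahnSeries.single (-((n * p ^ M : ℕ) : ℤ)) (∑ i ∈ Finset.range (M + 1),
        ((p ^ i : ℕ) : WittVector p k) * teichmuller p (y.out.coeff i) ^ p ^ (M - i)) := by
  rw [ghostComponent_eq_sum]
  refine Eq.trans (Finset.sum_congr rfl fun i hi => ?_)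
    (map_sum (HahnSeries.single.addMonoidHom (-((n * p ^ M : ℕ) : ℤ))) _ _).symm
  change _ = HahnSeries.single (-((n * p ^ M : ℕ) : ℤ)) _
  have hi' : i < M + 1 := Finset.mem_range.1 hi
  have h1 := coeff_teichLift (monomial n y) ⟨i, hi'⟩
  have h2 := TruncatedWittVector.coeff_out y ⟨i, hi'⟩
  rw [coeff_monomial, ← h2, teichLaurent_single] at h1
  dsimp only at h1 h2
  rw [h1, HahnSeries.single_pow]
  have e : p ^ (M - i) • -((n * p ^ i : ℕ) : ℤ) = -((n * p ^ M : ℕ) : ℤ) := by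
    have e : p ^ M = p ^ (M - i) * p ^ i := by
      rw [← pow_add, Nat.sub_add_cancel (by omega)]
    rw [e, nsmul_eq_mul]
    push_cast
    ring
  rw [e]
  ext1; funext j
  have := coeff_natCast_mul (p ^ i)
    (HahnSeries.single (-((n * p ^ M : ℕ) : ℤ)) (teichmuller p (y.out.coeff i) ^ p ^ (M - i))) j
  push_cast at this ⊢
  rw [this, HahnSeries.coeff_single, HahnSeries.coeff_single, mul_ite, mul_zero]

/-- The ghost component is a single term at `-np^M` with coefficient `∑ p^i [y_i]^(p^(M-i))`.
Applying `V^M` turns this into `p^M ∑ V^i [y_i]`, and the sum is the Witt vector with components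
`y_i`. -/
theorem iterate_verschiebung_twist_monomial {M n : ℕ} (hn : 0 < n) (y : W p M k) :
    ∃ Y : WittVector p k, WittVector.truncate (M + 1) Y = y ∧
      verschiebung^[M] (twist p k n M (ghostComponent M (teichLift (monomial n y)))) =
        ((p ^ M : ℕ) : WittVector p k) * Y := by
  refine ⟨∑ i ∈ Finset.range (M + 1), verschiebung^[i] (teichmuller p (y.out.coeff i)), ?_, ?_⟩
  · ext i
    rw [WittVector.coeff_truncate, coeff_sum_iterate_verschiebung_teichmuller, if_pos i.2,
      TruncatedWittVector.coeff_out]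
  · rw [ghostComponent_teichLift_monomial, twist_single hn, iterate_verschiebung_sum,
      Finset.mul_sum]
    refine Finset.sum_congr rfl fun i hi => ?_
    rw [iterate_verschiebung_natCast_mul, p_pow_mul_iterate_verschiebung_teichmuller_pow]
    have := Finset.mem_range.1 hi
    omega

theorem ghostComponent_iterate_verschiebung {A : Type*} [CommRing A] (s M : ℕ)
    (x : WittVector p A) : ghostComponent (M + s) (verschiebung^[s] x) =
      ((p ^ s : ℕ) : A) * ghostComponent M x := by
  induction s with
  | zero => simp
  | succ s ih =>
    rw [Function.iterate_succ_apply', ← add_assoc, ghostComponent_verschiebung, ih]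
    push_cast
    ring

theorem vanishesBelow_order (a : k⸨X⸩) : VanishesBelow a.order a :=
  fun _ hi => HahnSeries.coeff_eq_zero_of_lt_order hi

/-- A bound on the valuation of a Witt vector controls the twisted principal part of the ghost
component of its lift. -/
theorem ghostComponent_teichLift_of_le_val {N M n : ℕ} (hn : n.Coprime p) {z : W p N k⸨X⸩} {c : ℤ}
    (hz : (c : WithTop ℤ) ≤ val z) (hc : -((n * p ^ M : ℕ) : ℤ) < c) :
    (∀ r, M ≤ r → (ghostComponent N (teichLift z)).coeff (-((n * p ^ r : ℕ) : ℤ)) = 0) ∧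
      ((p ^ (N + 1) : ℕ) : WittVector p k) ∣
        verschiebung^[M] (twist p k n M (ghostComponent N (teichLift z))) := by
  rw [coe_le_val_iff] at hz
  have hterm : ∀ i ∈ Finset.range (N + 1),
      (∀ r, M ≤ r → (((p : (WittVector p k)⸨X⸩) ^ i *
        (teichLift z).coeff i ^ p ^ (N - i))).coeff (-((n * p ^ r : ℕ) : ℤ)) = 0) ∧
      ((p ^ (N + 1) : ℕ) : WittVector p k) ∣ verschiebung^[M] (twist p k n M
        ((p : (WittVector p k)⸨X⸩) ^ i * (teichLift z).coeff i ^ p ^ (N - i))) := by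
    intro i hi
    have hi' : i < N + 1 := Finset.mem_range.1 hi
    have h1 := coeff_teichLift z ⟨i, hi'⟩
    dsimp only at h1
    rw [h1, ← Nat.cast_pow p i]
    rcases hz ⟨i, hi'⟩ with h | h
    · rw [h, teichLaurent_zero, zero_pow (pow_ne_zero _ (Fact.out : p.Prime).ne_zero), mul_zero]
      refine ⟨fun _ _ => rfl, ?_⟩
      rw [map_zero, iterate_map_zero]
      exact dvd_zero _
    · have hv := vanishesBelow_order (z.coeff ⟨i, hi'⟩)
      refine ⟨fun r hr => ?_, ?_⟩
      · refine VanishesBelow.coeff_neg_eq_zero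
          (((hv.teichLaurent (p := p)).pow (p ^ (N - i))).natCast_mul (p ^ i)) ?_ hr
        push_cast at hc ⊢
        exact lt_of_lt_of_le hc h
      -- The valuation bound is precisely the pole condition for `z_i^(p^(N-i))`; its `N - i + 1`
      -- factors join the prefactor `p^i` to give `p^(N+1)`.
      · obtain ⟨q, hq⟩ := pow_dvd_twist_teichLaurent_pow hn _ hv M (N - i) (lt_of_lt_of_le hc h)
        rw [twist_natCast_mul, iterate_verschiebung_natCast_mul, hq, ← mul_assoc, ← Nat.cast_mul,
          ← pow_add, show i + (N - i + 1) = N + 1 by omega]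
        exact dvd_mul_right _ _
  rw [ghostComponent_eq_sum]
  refine ⟨fun r hr => ?_, ?_⟩
  · rw [HahnSeries.coeff_sum]
    exact Finset.sum_eq_zero fun i hi => (hterm i hi).1 r hr
  · rw [map_sum, iterate_verschiebung_sum]
    exact Finset.dvd_sum fun i hi => (hterm i hi).2

theorem iterate_frobenius_sub (T : ℕ) (x y : WittVector p k) :
    WittVector.frobenius^[T] (x - y) = WittVector.frobenius^[T] x - WittVector.frobenius^[T] y :=
  iterate_map_sub _ _ _ _

theorem iterate_verschiebung_iterate_frobenius_comm (M T : ℕ) (x : WittVector p k) :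
    verschiebung^[M] (WittVector.frobenius^[T] x) = WittVector.frobenius^[T] (verschiebung^[M] x) :=
  (verschiebung_frobenius_comm (p := p) (R := k)).iterate_iterate M T x

theorem p_dvd_of_frob_sub_eq {M N n : ℕ} (hn : n.Coprime p) (hMN : M ≤ N) {y : W p M k}
    {z w : W p N k⸨X⸩} {c : ℤ} (hz : (c : WithTop ℤ) ≤ val z) (hc : -((n * p ^ M : ℕ) : ℤ) < c)
    (hw : frob w - w = vMap M N hMN (monomial n y) - z) : (p : W p M k) ∣ y := by
  have hn0 : 0 < n := Nat.pos_of_ne_zero fun h => by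
    rw [h, Nat.coprime_zero_left] at hn
    exact (Fact.out : p.Prime).ne_one hn
  obtain ⟨s, rfl⟩ := Nat.exists_eq_add_of_le hMN
  obtain ⟨Y, hYy, hY⟩ := iterate_verschiebung_twist_monomial hn0 y
  obtain ⟨hZ0, Q, hQ⟩ := ghostComponent_teichLift_of_le_val hn hz hc
  set gX := ghostComponent M (teichLift (monomial n y)) with hgX
  set gZ := ghostComponent (M + s) (teichLift z) with hgZ
  set gW := ghostComponent (M + s) (teichLift w) with hgW
  -- `U` lifts the two sides' difference in the Artin–Schreier–Witt equation, so its components of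
  -- index at most `M + s` reduce to zero.
  set U : WittVector p (WittVector p k)⸨X⸩ := verschiebung^[s] (teichLift (monomial n y)) -
    teichLift z - (WittVector.map (frobLaurent p k) (teichLift w) - teichLift w) with hU
  have hgU : ghostComponent (M + s) U =
      ((p ^ s : ℕ) : (WittVector p k)⸨X⸩) * gX - gZ - (frobLaurent p k gW - gW) := by
    rw [hU, map_sub, map_sub, map_sub, ghostComponent_iterate_verschiebung, ghostComponent_map]
  have h2 : ∀ x : WittVector p (WittVector p k)⸨X⸩,
      WittVector.map (redLaurent p k) (verschiebung^[s] x) =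
        verschiebung^[s] (WittVector.map (redLaurent p k) x) := fun x =>
    Function.Semiconj.iterate_right (fun x => map_verschiebung (redLaurent p k) x) s x
  have hred : WittVector.truncate (M + s + 1) (WittVector.map (redLaurent p k) U) = 0 := by
    have h1 : WittVector.truncate (M + s + 1) (WittVector.map (redLaurent p k)
        (verschiebung^[s] (teichLift (monomial n y)))) = vMap M (M + s) hMN (monomial n y) := by
      conv_rhs => rw [← truncate_map_teichLift (monomial n y), vMap_truncate,
        Nat.add_sub_cancel_left]
      rw [h2]
    have h3 : WittVector.truncate (M + s + 1) (WittVector.map (redLaurent p k)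
        (WittVector.map (frobLaurent p k) (teichLift w))) = frob w := by
      conv_rhs => rw [← truncate_map_teichLift w, frob_truncate]
      congr 1
      ext i
      rw [coeff_frobenius_charP, map_coeff, map_coeff, map_coeff, redLaurent_frobLaurent]
    rw [hU, map_sub, map_sub, map_sub, map_sub, map_sub, map_sub, h1, h3,
      truncate_map_teichLift, truncate_map_teichLift, hw, sub_self]
  have hUV : VDivisible (M + s) (ghostComponent (M + s) U) := by
    refine vDivisible_ghostComponent fun i hi => vDivisible_zero_of_redLaurent_eq_zero ?_
    rw [← RingHom.mem_ker, WittVector.mem_ker_truncate] at hred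
    have := hred i (by omega)
    rwa [map_coeff] at this
  obtain ⟨v, hv⟩ := exists_vanishesBelow gW
  -- As `np^(M+T) > M + T > |v|`, the series `gW` has no coefficient at `-np^(M+T)`. The `+ 1` also
  -- makes `M + T` a successor.
  set T : ℕ := v.natAbs + 1 with hT
  obtain ⟨C, hC⟩ := hUV.exists_twist_eq n (M + T)
  have hX0 : ∀ r, M < r → gX.coeff (-((n * p ^ r : ℕ) : ℤ)) = 0 := by
    intro r hr
    rw [hgX, ghostComponent_teichLift_monomial]
    refine HahnSeries.coeff_single_of_ne fun e => ?_
    have := Nat.mul_lt_mul_of_pos_left (Nat.pow_lt_pow_right (Fact.out : p.Prime).one_lt hr) hn0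
    have e' := neg_injective e
    norm_cast at e'
    omega
  -- The range is now so long that `F` of the twist one step shorter equals the full twist, so the
  -- coboundary `φ gW - gW` is killed.
  have hW : twist p k n (M + T) (frobLaurent p k gW) = twist p k n (M + T) gW := by
    have hlt : M + T < p ^ (M + T) := Nat.lt_pow_self (Fact.out : p.Prime).one_lt
    have hle : p ^ (M + T) ≤ n * p ^ (M + T) := Nat.le_mul_of_pos_left _ hn0
    have h0 := hv (-((n * p ^ (M + T) : ℕ) : ℤ)) (by omega)
    rw [hT, ← add_assoc] at h0 ⊢
    rw [twist_succ_frobLaurent hn, twist_succ, h0, add_zero]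
  clear_value T gX gZ gW
  -- `V^M` is applied to the twisted ghost identity; each term is then a multiple of `p^(M+s)`,
  -- which cancels in the domain `W(k)`.
  have hmain : WittVector.frobenius^[T] (Y - (p : WittVector p k) * Q) = verschiebung^[M + 1] C := by
    refine mul_left_cancel₀ (natCast_p_pow_ne_zero (p := p) (k := k) (M + s)) ?_
    have h1 : twist p k n (M + T) (ghostComponent (M + s) U) =
        WittVector.frobenius^[T] (((p ^ s : ℕ) : WittVector p k) * twist p k n M gX -
          twist p k n M gZ) := by
      rw [hgU, map_sub, map_sub, map_sub, hW, sub_self, sub_zero, twist_natCast_mul,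
        twist_add_of_coeff_eq_zero hX0, twist_add_of_coeff_eq_zero fun r hr => hZ0 r hr.le,
        iterate_frobenius_sub, iterate_map_mul]
      congr 2
      exact (Function.iterate_fixed (map_natCast _ _) T).symm
    have h2 := congrArg (fun x => verschiebung^[M] x) (h1.symm.trans hC)
    simp only [iterate_verschiebung_iterate_frobenius_comm, iterate_map_sub,
      iterate_verschiebung_natCast_mul, hY, hQ] at h2
    rw [Function.iterate_succ_apply _ M, ← h2]
    have h3 : ((p ^ (M + s) : ℕ) : WittVector p k) =
        WittVector.frobenius^[T] ((p ^ (M + s) : ℕ) : WittVector p k) :=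
      (Function.iterate_fixed (map_natCast _ _) T).symm
    have h4 : ((p ^ (M + s) : ℕ) : WittVector p k) * (Y - (p : WittVector p k) * Q) =
        ((p ^ s : ℕ) : WittVector p k) * (((p ^ M : ℕ) : WittVector p k) * Y) -
          ((p ^ (M + s + 1) : ℕ) : WittVector p k) * Q := by
      push_cast
      ring
    rw [← iterate_frobenius_sub, ← h4, iterate_map_mul, ← h3]
  refine ⟨WittVector.truncate (M + 1) Q, ?_⟩
  rw [← hYy, ← sub_eq_zero]
  have : WittVector.truncate (M + 1) (Y - (p : WittVector p k) * Q) = 0 := by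
    rw [← RingHom.mem_ker, WittVector.mem_ker_truncate]
    intro i hi
    -- `F^T` raises components to the power `p^T`, so their vanishing descends through it without
    -- `k` being perfect.
    have h := congrArg (fun x => WittVector.coeff x i) hmain
    simp only [iterate_verschiebung_coeff_eq_zero _ hi, iterate_frobenius_coeff] at h
    exact pow_eq_zero_iff (pow_ne_zero _ (Fact.out : p.Prime).ne_zero) |>.1 h
  simpa using this

end LowerBound

/-! ### Reduction to `p ∤ y` and computation of the Swan conductor. -/

section SwanConductor

set_option linter.unusedSectionVars false

variable {p : ℕ} [Fact p.Prime] {k : Type*} [Field k] [CharP k p]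
  {Esep : Type*} [Field Esep] [Algebra k⸨X⸩ Esep] [IsSepClosure k⸨X⸩ Esep]

theorem delta_comonomial_mem_filChar {M n : ℕ} (y : W p M k) :
    delta p k⸨X⸩ Esep (comonomial n y) ∈ filChar p k Esep (n * p ^ M) :=
  ⟨_, ⟨M, monomial n y, le_val_monomial n y, rfl⟩, rfl⟩

theorem delta_comonomial_notMem_filChar {M n d : ℕ} (hn : n.Coprime p) {y : W p M k}
    (hy : ¬ (p : W p M k) ∣ y) (hd : d < n * p ^ M) :
    delta p k⸨X⸩ Esep (comonomial n y) ∉ filChar p k Esep d := by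
  rintro ⟨_, ⟨s, z, hz, rfl⟩, h⟩
  rw [comonomial_eq] at h
  obtain ⟨w, hw⟩ := exists_frob_sub_of_delta_eq (Nat.le_add_right M s) (Nat.le_add_left s M) h.symm
  exact hy (p_dvd_of_frob_sub_eq hn _ (coe_le_val_vMap _ hz) (by omega) hw)

theorem coeff_iterate_frob {R : Type*} [CommRing R] {m : ℕ} (x : W p m R) (j : ℕ)
    (l : Fin (m + 1)) : (frob^[j] x).coeff l = x.coeff l ^ p ^ j := by
  induction j with
  | zero => simp
  | succ j ih =>
    rw [Function.iterate_succ_apply', frob, TruncatedWittVector.coeff_mk, ih, ← pow_mul, pow_succ]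

/-- Multiplication by `p^j` shifts the components of `μ` by `j` places and raises them to the power
`p^j`. The exponents of `t` scale in the same way, so the first Witt vector is `V^j F^j` of the
second, with the same character. -/
theorem delta_comonomial_p_pow_mul {m j n : ℕ} (hj : j ≤ m) (μ : WittVector p k) :
    delta p k⸨X⸩ Esep
        (comonomial n (WittVector.truncate (m + 1) ((p : WittVector p k) ^ j * μ) : W p m k)) =
      delta p k⸨X⸩ Esep
        (comonomial n (WittVector.truncate (m - j + 1) μ : W p (m - j) k)) := by
  have hfrob : ∀ (i : ℕ) (x : W p (m - j) k⸨X⸩), delta p k⸨X⸩ Esep (toCW p _ _ (frob^[i] x)) =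
      delta p k⸨X⸩ Esep (toCW p _ _ x) := by
    intro i x
    induction i with
    | zero => rfl
    | succ i ih => rw [Function.iterate_succ_apply', delta_toCW_frob, ih]
  rw [comonomial_eq, comonomial_eq, ← hfrob j, ← toCW_vMap (Nat.sub_le m j)]
  congr 2
  refine TruncatedWittVector.ext fun l => ?_
  rw [coeff_monomial, coeff_vMap, WittVector.coeff_truncate,
    mul_comm ((p : WittVector p k) ^ j)]
  split_ifs with hl
  · rw [mul_pow_charP_coeff_zero _ (by omega), map_zero]
  · rw [coeff_iterate_frob, coeff_monomial, WittVector.coeff_truncate, HahnSeries.single_pow]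
    have e : (l : ℕ) = ((l : ℕ) - (m - (m - j))) + j := by omega
    have e1 : ((n * p ^ (l : ℕ) : ℕ) : ℤ) =
        ((p ^ j * (n * p ^ ((l : ℕ) - (m - (m - j)))) : ℕ) : ℤ) := by
      conv_lhs => rw [e, pow_add]
      ring_nf
    have e2 : (μ * (p : WittVector p k) ^ j).coeff (l : ℕ) =
        μ.coeff ((l : ℕ) - (m - (m - j))) ^ p ^ j := by
      conv_lhs => rw [e, mul_pow_charP_coeff_succ]
    rw [e2, e1, nsmul_eq_mul]
    push_cast
    rw [mul_neg]

/-- Multiplication by `p^j = V^j F^j` carries a congruence modulo `V^(m-j+1)` to one modulo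
`V^(m+1)`. -/
theorem p_pow_dvd_truncate_of_dvd {m j : ℕ} (hj : j ≤ m) (μ : WittVector p k)
    (h : (p : W p (m - j) k) ∣ WittVector.truncate (m - j + 1) μ) :
    (p : W p m k) ^ (j + 1) ∣ WittVector.truncate (m + 1) ((p : WittVector p k) ^ j * μ) := by
  obtain ⟨q, hq⟩ := h
  obtain ⟨q, rfl⟩ := WittVector.truncate_surjective p (m - j + 1) k q
  have h0 : WittVector.truncate (m - j + 1) (μ - (p : WittVector p k) * q) = 0 := by
    rw [map_sub, hq, map_mul, map_natCast, sub_self]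
  rw [← RingHom.mem_ker, WittVector.mem_ker_truncate] at h0
  refine ⟨WittVector.truncate (m + 1) q, ?_⟩
  have h1 : WittVector.truncate (m + 1) ((μ - (p : WittVector p k) * q) * (p : WittVector p k) ^ j) = 0 := by
    rw [← RingHom.mem_ker, WittVector.mem_ker_truncate]
    intro i hi
    rcases lt_or_ge i j with hij | hij
    · exact mul_pow_charP_coeff_zero _ hij
    · rw [← Nat.sub_add_cancel hij, mul_pow_charP_coeff_succ, h0 _ (by omega),
        zero_pow (pow_ne_zero _ (Fact.out : p.Prime).ne_zero)]
  rw [map_mul, map_sub, map_mul, map_pow, map_natCast] at h1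
  rw [map_mul, map_pow, map_natCast]
  linear_combination h1

theorem p_pow_eq_zero {m j : ℕ} (hj : m < j) : (p : W p m k) ^ j = 0 := by
  have h : WittVector.truncate (m + 1) ((1 : WittVector p k) * (p : WittVector p k) ^ j) = 0 := by
    rw [← RingHom.mem_ker, WittVector.mem_ker_truncate]
    exact fun i hi => mul_pow_charP_coeff_zero _ (by omega)
  simpa using h

theorem push_proj_push_incl (χ : Char Gal(Esep/k⸨X⸩) (QpModZp p)) :
    Char.push (proj p) (Char.push (incl p) χ) = χ :=
  DFunLike.ext _ _ fun g => proj_incl p (χ g)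

/-- The infimum of an empty set of naturals is `0`, so membership at `N` is also what guarantees
that the minimum is attained. -/
theorem sw_push_incl_eq {χ : Char Gal(Esep/k⸨X⸩) (QpModZp p)} {N : ℕ}
    (h : χ ∈ filChar p k Esep N) (h' : ∀ d < N, χ ∉ filChar p k Esep d) :
    sw p (Char.push (incl p) χ) = N := by
  rw [sw, push_proj_push_incl]
  refine le_antisymm (Nat.sInf_le h) (le_of_not_gt fun hlt => ?_)
  exact h' _ hlt (Nat.sInf_mem (s := {d | χ ∈ filChar p k Esep d}) ⟨N, h⟩)

end SwanConductor

end KatoSwan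

end
open scoped LaurentSeries in
theorem corollary4 {p : ℕ} [Fact p.Prime] {k : Type*} [Field k] [CharP k p]
    {Esep : Type*} [Field Esep] [Algebra k⸨X⸩ Esep] [IsSepClosure k⸨X⸩ Esep]
    (m n j : ℕ) (hn : n.Coprime p) (lam : KatoSwan.W p m k)
    (hlam : (p : KatoSwan.W p m k) ^ j ∣ lam) (hlam' : ¬ (p : KatoSwan.W p m k) ^ (j + 1) ∣ lam) :
    j ≤ m ∧
      KatoSwan.sw p (KatoSwan.Char.push (KatoSwan.incl p)
        (KatoSwan.delta p k⸨X⸩ Esep (KatoSwan.comonomial n lam))) = n * p ^ (m - j) := by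
  obtain ⟨μ, rfl⟩ := hlam
  have hj : j ≤ m := by
    by_contra! h
    exact hlam' (by rw [KatoSwan.p_pow_eq_zero h, zero_mul]; exact dvd_zero _)
  refine ⟨hj, ?_⟩
  obtain ⟨μ, rfl⟩ := WittVector.truncate_surjective p (m + 1) k μ
  have e : (p : KatoSwan.W p m k) ^ j * WittVector.truncate (m + 1) μ =
      WittVector.truncate (m + 1) ((p : WittVector p k) ^ j * μ) := by simp
  rw [e] at hlam' ⊢
  rw [KatoSwan.delta_comonomial_p_pow_mul hj]
  exact KatoSwan.sw_push_incl_eq (KatoSwan.delta_comonomial_mem_filChar _) fun d hd =>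
    KatoSwan.delta_comonomial_notMem_filChar hn
      (fun h => hlam' (KatoSwan.p_pow_dvd_truncate_of_dvd hj μ h)) hd
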